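/- Let $\sigma$ be a finite relational signature with unary and binary symbols only, containing a distinguished binary symbol $T$; let $|\sigma|$ be its number of symbols. Structures are non-empty, and models are required to interpret $T$ as a transitive relation. A normal-form sentence with transitive witnesses is a sentence $$\Psi=\forall x\forall y\,\psi_0\;\wedge\;\bigwedge_{i=1}^{m}\gamma_i\;\wedge\;\bigwedge_{i=1}^{\overline m}\delta_i ,$$ where each $\gamma_i$ is $\forall x\exists y\,(Txy\wedge\neg Tyx\wedge\psi_i)$ or $\forall x\exists y\,(\neg Txy\wedge Tyx\wedge\psi_i)$, each $\delta_i$ is $\forall x\exists y\,(Txy\wedge Tyx\wedge\chi_i)$, and $\psi_0,\psi_i,\chi_i$ are quantifier-free $\sigma$-formulas (with equality) in the variables $x,y$. Let $\mathfrak A$ be a $\sigma$-structure with universe $A$. A clique is a maximal set $B\subseteq A$ such that $Tbc$ and $Tcb$ for all distinct $b,c\in B$. Write $b<c$ if $Tbc$ and not $Tcb$. The splice of a clique $B$ is the triple consisting of the isomorphism type of the substructure induced by $B$, the set of atomic 1-types of those $a\in A$ with $a<b$ for all $b\in B$, and the set of atomic 1-types of those $a\in A$ with $b<a$ for all $b\in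 B$. Let $Sp^{\mathfrak A}$ be the set of splices of cliques of $\mathfrak A$, and let $K(\mathfrak A)$ be the union of those cliques whose splice is not the splice of any other clique. For $a\in A$ let $W_i^{\mathfrak A}(a)$ be the set of all $b\neq a$ that are witnesses of $\gamma_i$ for $a$ in $\mathfrak A$. **Lemma.** There is an absolute constant $c$ such that, for every such $\sigma$ and $\Psi$, with $h=2^{c|\sigma|}$: if $\Psi$ has a model, then $\Psi$ has a model $\mathfrak A$ in which every clique has at most $h$ elements, $s:=|Sp^{\mathfrak A}|\le 2^{2^{c|\sigma|}}$, and which is narrow in the following sense, where $\mathbb M=(m+1)\cdot s^2\cdot h$. Either $A=K(\mathfrak A)$, or $A$ has an infinite partition $\{S_0,S_1,\dots\}$ into non-empty sets such that $K(\mathfrak A)\subseteq S_0$ and for every $j\ge 0$: 1. $|S_j|\le\mathbb M$; 2. for every $a\in S_0\cup\dots\cup S_j$ and every $i\in\{1,\dots,m\}$, if $W_i^{\mathfrak A}(a)\cap S_0=\emptyset$, then $W_i^{\mathfrak A}(a)\cap S_{j+1}\neq\emptyset$. -/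

import Mathlib

open FirstOrder

universe u v w

namespace TransWit

/-- The direction of a conjunct `γ_i`: `fwd` demands `Txy ∧ ¬Tyx`, `bwd` demands `¬Txy ∧ Tyx`. -/
inductive Dir where
  | fwd
  | bwd

/-- Quantifier-free formulas in two variables; `&0` is `x` and `&1` is `y`. -/
abbrev QF (L : FirstOrder.Language.{u, v}) : Type (max u v) :=
  {ψ : L.BoundedFormula Empty 2 // ψ.IsQF}

/-- The data of a normal-form sentence with transitive witnesses
`∀x∀y ψ₀ ∧ ⋀_{i<m} ∀x∃y ψ_i^{d_i} ∧ ⋀_{i<m'} ∀x∃y χ_i^{↔}`, with each `d_i` in `{→, ←}`. -/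
structure NormalForm (L : FirstOrder.Language.{u, v}) where
  psi0 : QF L
  m : ℕ
  gammaDir : Fin m → Dir
  gammaPsi : Fin m → QF L
  mBar : ℕ
  deltaPsi : Fin mBar → QF L

section NormalForms

variable {L : FirstOrder.Language.{u, v}} (T : L.Relations 2)

/-- The atom `Txy`. -/
def atomXY : L.BoundedFormula Empty 2 := T.boundedFormula₂ (&0) (&1)

/-- The atom `Tyx`. -/
def atomYX : L.BoundedFormula Empty 2 := T.boundedFormula₂ (&1) (&0)

/-- `ψ^→ = Txy ∧ ¬Tyx ∧ ψ` and `ψ^← = ¬Txy ∧ Tyx ∧ ψ`. -/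
def withDir : Dir → L.BoundedFormula Empty 2 → L.BoundedFormula Empty 2
  | Dir.fwd, ψ => atomXY T ⊓ (∼(atomYX T) ⊓ ψ)
  | Dir.bwd, ψ => ∼(atomXY T) ⊓ (atomYX T ⊓ ψ)

/-- `ψ^↔ = Txy ∧ Tyx ∧ ψ`. -/
def withBoth (ψ : L.BoundedFormula Empty 2) : L.BoundedFormula Empty 2 :=
  atomXY T ⊓ (atomYX T ⊓ ψ)

namespace NormalForm

/-- The matrix `ψ_i^{d_i}(x,y)` of the conjunct `γ_i`. -/
def gammaMatrix (Ψ : NormalForm L) (i : Fin Ψ.m) : L.BoundedFormula Empty 2 :=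
  withDir T (Ψ.gammaDir i) (Ψ.gammaPsi i).1

/-- The conjunct `γ_i = ∀x∃y ψ_i^{d_i}(x,y)`. -/
def gamma (Ψ : NormalForm L) (i : Fin Ψ.m) : L.Sentence := (Ψ.gammaMatrix T i).ex.all

/-- The conjunct `δ_i = ∀x∃y ψ_i^{↔}(x,y)`. -/
def delta (Ψ : NormalForm L) (i : Fin Ψ.mBar) : L.Sentence :=
  (withBoth T (Ψ.deltaPsi i).1).ex.all

/-- The first-order sentence `∀x∀y ψ₀ ∧ ⋀ γ_i ∧ ⋀ δ_i`. -/
noncomputable def toSentence (Ψ : NormalForm L) : L.Sentence :=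
  Ψ.psi0.1.all.all ⊓
    (FirstOrder.Language.BoundedFormula.iInf (Ψ.gamma T) ⊓
      FirstOrder.Language.BoundedFormula.iInf (Ψ.delta T))

end NormalForm

end NormalForms

section Semantics

variable {L : FirstOrder.Language.{u, v}} (T : L.Relations 2) {A : Type w} [L.Structure A]

/-- The interpretation of `T` in the structure `A`. -/
def rel (a b : A) : Prop := FirstOrder.Language.Structure.RelMap T ![a, b]

/-- `A ⊨ Ψ` in the semantics in which the universe is non-empty and `T` is transitive. -/
def IsModel (Ψ : NormalForm L) (A : Type w) [L.Structure A] : Prop :=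
  Nonempty A ∧ (∀ a b c : A, rel T a b → rel T b c → rel T a c) ∧ A ⊨ Ψ.toSentence T

/-- Every two distinct elements of `B` are `T`-related in both directions. -/
def TConnected (B : Set A) : Prop := B.Pairwise fun b c => rel T b c ∧ rel T c b

/-- Cliques are the maximal `T`-connected subsets. -/
def IsClique (B : Set A) : Prop := Maximal (TConnected T) B

/-- `b < c`: `Tbc` but not `Tcb`. -/
def below (b c : A) : Prop := rel T b c ∧ ¬ rel T c b

/-- The 1-type of `a`, given by the set of its positive atoms: with only one variable, the atoms
(other than `x = x`) are the `R x … x`, one for each relation symbol `R`. -/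
def oneType (L : FirstOrder.Language.{u, v}) {A : Type w} [L.Structure A] (a : A) :
    Set (Σ n, L.Relations n) :=
  {R | FirstOrder.Language.Structure.RelMap R.2 (fun _ => a)}

/-- The 1-types of the elements below all of `B`. -/
def inTypes (B : Set A) : Set (Set (Σ n, L.Relations n)) :=
  {t | ∃ a : A, (∀ b ∈ B, below T a b) ∧ oneType L a = t}

/-- The 1-types of the elements above all of `B`. -/
def outTypes (B : Set A) : Set (Set (Σ n, L.Relations n)) :=
  {t | ∃ a : A, (∀ b ∈ B, below T b a) ∧ oneType L a = t}

/-- The induced substructure on a subset (the language is relational). -/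
def induced (L : FirstOrder.Language.{u, v}) [L.IsRelational] {A : Type w} [L.Structure A]
    (B : Set A) : L.Substructure A where
  carrier := B
  fun_mem := fun f => isEmptyElim f

/-- Isomorphism types of structures over `L` with universe in `Type w`. -/
abbrev IsoType (L : FirstOrder.Language.{u, v}) : Type (max u v (w + 1)) :=
  Quotient (FirstOrder.Language.equivSetoid (L := L) :
    Setoid (CategoryTheory.Bundled.{w} L.Structure))

/-- The isomorphism type of the substructure induced by `B`. -/
def isoType (L : FirstOrder.Language.{u, v}) [L.IsRelational] {A : Type w} [L.Structure A]
    (B : Set A) : IsoType.{u, v, w} L :=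
  Quotient.mk _ (CategoryTheory.Bundled.of (induced L B))

variable [L.IsRelational]

/-- The splice of `B`: the triple of its isomorphism type, `In(B)` and `Out(B)`. -/
def splice (B : Set A) :
    IsoType.{u, v, w} L × Set (Set (Σ n, L.Relations n)) × Set (Set (Σ n, L.Relations n)) :=
  (isoType L B, inTypes T B, outTypes T B)

/-- The set `Sp` of all splices of the structure `A`. -/
def splices (A : Type w) [L.Structure A] :
    Set (IsoType.{u, v, w} L × Set (Set (Σ n, L.Relations n)) ×
      Set (Set (Σ n, L.Relations n))) :=
  {p | ∃ B : Set A, IsClique T B ∧ splice T B = p}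

/-- `B` is a clique with a unique splice. -/
def IsUniqueClique (B : Set A) : Prop :=
  IsClique T B ∧ ¬ ∃ C : Set A, IsClique T C ∧ splice T B = splice T C ∧ B ≠ C

/-- `K(A)`: the union of all cliques with unique splices. -/
def uniquePart (A : Type w) [L.Structure A] : Set A :=
  {a | ∃ B : Set A, IsUniqueClique T B ∧ a ∈ B}

/-- `W_i(a)`: the set of all proper `γ_i`-witnesses of `a`. -/
def witnesses (Ψ : NormalForm L) (i : Fin Ψ.m) (a : A) : Set A :=
  {b | (Ψ.gammaMatrix T i).Realize default ![a, b] ∧ a ≠ b}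

/-- `|σ|`, the number of symbols of the signature. -/
noncomputable def sigSize (L : FirstOrder.Language.{u, v}) : ℕ := Nat.card (Σ n, L.Relations n)

/-- The bound `h = 2^(c|σ|)` on the size of cliques. -/
noncomputable def cliqueBound (L : FirstOrder.Language.{u, v}) (c : ℕ) : ℕ := 2 ^ (c * sigSize L)

/-- The bound `𝕄 = (m + 1) · s² · h` on the size of segments, where `s` is the number of splices
of `A` and `h` bounds the size of cliques. -/
noncomputable def segmentBound (Ψ : NormalForm L) (A : Type w) [L.Structure A] (h : ℕ) : ℕ :=
  (Ψ.m + 1) * (splices T A).ncard ^ 2 * h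

/-- The cliques of `A` have at most `h = 2^(c|σ|)` elements; consequently the number of splices
is finite, and at most doubly exponential. -/
def HasSmallCliques (A : Type w) [L.Structure A] (c : ℕ) : Prop :=
  (∀ B : Set A, IsClique T B → B.encard ≤ (cliqueBound L c : ℕ)) ∧
    (splices T A).encard ≤ ((2 ^ 2 ^ (c * sigSize L) : ℕ) : ℕ∞)

/-- `A` is narrow (with clique bound `h`): either all cliques of `A` have unique splices, or `A`
has an infinite partition `S 0, S 1, …` as described. -/
def IsNarrow (Ψ : NormalForm L) (A : Type w) [L.Structure A] (h : ℕ) : Prop :=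
  uniquePart T A = Set.univ ∨
    ∃ S : ℕ → Set A,
      (∀ j, (S j).Nonempty) ∧ Pairwise (Function.onFun Disjoint S) ∧ (⋃ j, S j) = Set.univ ∧
      uniquePart T A ⊆ S 0 ∧
      ∀ j, (S j).encard ≤ (segmentBound T Ψ A h : ℕ) ∧
        ∀ a ∈ ⋃ k ∈ Set.Iic j, S k, ∀ i : Fin Ψ.m,
          witnesses T Ψ i a ∩ S 0 = ∅ → (witnesses T Ψ i a ∩ S (j + 1)).Nonempty

end Semantics

end TransWit

/-! By Löwenheim–Skolem one may start from a countable model. It is then rebuilt, twice if some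
clique can be copied, through `exists_structure_of_pairs`: as symbols are unary or binary, a
structure amounts to a 1-type for each point and a 2-type for each pair of distinct points. If all
of these are borrowed from a model, `∀x∀y ψ₀` survives, and only transitivity and the witnesses need
care.

Small cliques (`exists_model_small_cliques`). Twins, i.e. elements of one clique with equal 1-types,
are `T`-related alike to all other elements, so 2-types between the same two twin classes can be
exchanged without disturbing the order. A twin class shrinks to its only member (a king), or to some
court elements and three layers of copies of a representative, one copy per 2-type in each layer.
Copies find witnesses in the court or in the next layer modulo 3, so no pair receives two demands.

Narrowness (`exists_narrow_model`). `Reach B C` depends only on splices, is transitive, and follows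
from `B < C`; it allows a copy of `C` above a copy of `B`. A clique is `Multi` if its splice is
shared or it reaches itself. If no clique is `Multi`, all splices are unique. Otherwise segment 0
consists of one clique per splice and the cliques of witnesses for non-`Multi` cliques; each later
segment has `m + 1` copies of every chosen `Multi` clique, one spare and one for each `γ_i`. Copies
are ordered by `Reach`, and mutual `Reach` is decided by a height that puts the copy for `γ_i`
beyond all earlier segments in the direction of `γ_i`. Hence a witness between two `Multi` cliques
recurs in every later segment, and other witnesses lie in segment 0. Spare copies alternate between
high and low, which preserves all splices. -/

namespace TransWit

/-! ### Types of pairs and the semantics of normal forms -/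

section Diagrams

open FirstOrder.Language FirstOrder.Language.Structure

/-- A relation symbol with arguments taken from `k` variables. -/
abbrev Code (L : FirstOrder.Language.{u, v}) (k : ℕ) : Type v :=
  Σ R : (Σ n, L.Relations n), (Fin R.1 → Fin k)

/-- The positive atoms (other than equalities) that hold of a tuple. -/
def diagram (L : FirstOrder.Language.{u, v}) {A : Type*} [L.Structure A] {k : ℕ}
    (x : Fin k → A) : Set (Code L k) :=
  {c | RelMap c.1.2 (x ∘ c.2)}

/-- The 2-type of a pair, without the information whether its members are equal. -/
abbrev pairType (L : FirstOrder.Language.{u, v}) {A : Type*} [L.Structure A] (a b : A) :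
    Set (Code L 2) :=
  diagram L ![a, b]

variable {L : FirstOrder.Language.{u, v}} {A : Type*} [L.Structure A]
  {B : Type*} [L.Structure B]

theorem diagram_comp {k l : ℕ} {x : Fin k → A} {y : Fin k → B} (h : diagram L x = diagram L y)
    (f : Fin l → Fin k) : diagram L (x ∘ f) = diagram L (y ∘ f) := by
  ext ⟨R, g⟩
  exact Set.ext_iff.1 h ⟨R, f ∘ g⟩

theorem pairType_swap {a b : A} {c d : B} (h : pairType L a b = pairType L c d) :
    pairType L b a = pairType L d c := by
  have := diagram_comp h ![1, 0]
  convert this using 2 <;> ext i <;> fin_cases i <;> rfl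

theorem comp_pair_self {C : Type*} {n : ℕ} (c : C) (f : Fin n → Fin 2) :
    ![c, c] ∘ f = fun _ => c := by
  ext i
  simp only [Function.comp]
  generalize f i = j
  fin_cases j <;> rfl

theorem comp_pair_zero {C : Type*} {n : ℕ} (c d : C) {f : Fin n → Fin 2} (h : ∀ i, f i = 0) :
    ![c, d] ∘ f = ![c, c] ∘ f := by
  ext i
  simp [h]

theorem comp_pair_one {C : Type*} {n : ℕ} (c d : C) {f : Fin n → Fin 2} (h : ∀ i, f i = 1) :
    ![c, d] ∘ f = ![d, d] ∘ f := by
  ext i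
  simp [h]

theorem mem_pairType_self {a : A} {R : Σ n, L.Relations n} {f : Fin R.1 → Fin 2} :
    (⟨R, f⟩ : Code L 2) ∈ pairType L a a ↔ R ∈ oneType L a := by
  change RelMap R.2 (![a, a] ∘ f) ↔ RelMap R.2 (fun _ => a)
  rw [comp_pair_self]

theorem pairType_self_iff {a : A} {b : B} :
    pairType L a a = pairType L b b ↔ oneType L a = oneType L b := by
  constructor
  · intro h
    ext R
    rw [← mem_pairType_self (f := fun _ => 0), h, mem_pairType_self]
  · intro h
    ext ⟨R, f⟩
    rw [mem_pairType_self, mem_pairType_self, h]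

theorem rel_iff_mem (T : L.Relations 2) {a b : A} :
    rel T a b ↔ (⟨⟨2, T⟩, id⟩ : Code L 2) ∈ pairType L a b := Iff.rfl

theorem rel_congr (T : L.Relations 2) {a b : A} {c d : B}
    (h : pairType L a b = pairType L c d) : rel T a b ↔ rel T c d := by
  rw [rel_iff_mem, rel_iff_mem, h]

theorem rel_self_congr (T : L.Relations 2) {a : A} {c : B}
    (h : oneType L a = oneType L c) : rel T a a ↔ rel T c c :=
  rel_congr T (pairType_self_iff.2 h)

/-- Quantifier-free formulas in two variables only depend on the 2-type. -/
theorem realize_congr [L.IsRelational] {φ : L.BoundedFormula Empty 2} (hφ : φ.IsQF)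
    {a b : A} {c d : B} (h : pairType L a b = pairType L c d) (he : a = b ↔ c = d) :
    φ.Realize default ![a, b] ↔ φ.Realize default ![c, d] := by
  have hterm : ∀ t : L.Term (Empty ⊕ Fin 2), ∃ i : Fin 2, t = Term.var (Sum.inr i) := by
    intro t
    cases t with
    | var x =>
      rcases x with x | i
      · exact x.elim
      · exact ⟨i, rfl⟩
    | func f _ => exact isEmptyElim f
  induction hφ with
  | falsum => rfl
  | of_isAtomic hat =>
    cases hat with
    | equal t₁ t₂ =>
      obtain ⟨i, rfl⟩ := hterm t₁
      obtain ⟨j, rfl⟩ := hterm t₂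
      simp only [BoundedFormula.realize_bdEqual, Term.realize_var, Sum.elim_inr]
      fin_cases i <;> fin_cases j <;> simp [he, eq_comm]
    | rel R ts =>
      choose f hf using fun i => hterm (ts i)
      have hts : ts = fun i => Term.var (Sum.inr (f i)) := funext hf
      subst hts
      simp only [BoundedFormula.realize_rel, Term.realize_var, Sum.elim_inr]
      exact Set.ext_iff.1 h ⟨⟨_, R⟩, f⟩
  | imp _ _ h₁ h₂ => simp only [BoundedFormula.realize_imp, h₁, h₂]

theorem isModel_iff (T : L.Relations 2) (Ψ : NormalForm L) :
    IsModel T Ψ A ↔ Nonempty A ∧ (∀ a b c : A, rel T a b → rel T b c → rel T a c) ∧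
      (∀ a b : A, Ψ.psi0.1.Realize default ![a, b]) ∧
      (∀ i, ∀ a : A, ∃ b, (Ψ.gammaMatrix T i).Realize default ![a, b]) ∧
      (∀ i, ∀ a : A, ∃ b, (withBoth T (Ψ.deltaPsi i).1).Realize default ![a, b]) := by
  have hs : ∀ a b : A, Fin.snoc (α := fun _ => A)
      (Fin.snoc (α := fun _ => A) (default : Fin 0 → A) a) b = ![a, b] := by
    intro a b
    ext i
    fin_cases i <;> rfl
  simp only [IsModel, NormalForm.toSentence, NormalForm.gamma, NormalForm.delta,
    Sentence.Realize, Formula.Realize, BoundedFormula.realize_inf, BoundedFormula.realize_iInf,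
    BoundedFormula.realize_all, BoundedFormula.realize_ex, hs]

theorem withDir_isQF (T : L.Relations 2) (d : Dir) {ψ : L.BoundedFormula Empty 2}
    (h : ψ.IsQF) : (withDir T d ψ).IsQF := by
  have hx : (atomXY T).IsQF := (BoundedFormula.IsAtomic.rel _ _).isQF
  have hy : (atomYX T).IsQF := (BoundedFormula.IsAtomic.rel _ _).isQF
  cases d
  · exact hx.inf (hy.not.inf h)
  · exact hx.not.inf (hy.inf h)

theorem withBoth_isQF (T : L.Relations 2) {ψ : L.BoundedFormula Empty 2}
    (h : ψ.IsQF) : (withBoth T ψ).IsQF := by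
  have hx : (atomXY T).IsQF := (BoundedFormula.IsAtomic.rel _ _).isQF
  have hy : (atomYX T).IsQF := (BoundedFormula.IsAtomic.rel _ _).isQF
  exact hx.inf (hy.inf h)

theorem realize_atomXY (T : L.Relations 2) (a b : A) :
    (atomXY T).Realize default ![a, b] ↔ rel T a b := by
  simp [atomXY, rel, BoundedFormula.realize_rel₂]

theorem realize_atomYX (T : L.Relations 2) (a b : A) :
    (atomYX T).Realize default ![a, b] ↔ rel T b a := by
  simp [atomYX, rel, BoundedFormula.realize_rel₂]

theorem realize_withDir_fwd (T : L.Relations 2) (ψ : L.BoundedFormula Empty 2) (a b : A) :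
    (withDir T Dir.fwd ψ).Realize default ![a, b] ↔
      below T a b ∧ ψ.Realize default ![a, b] := by
  simp only [withDir, BoundedFormula.realize_inf, BoundedFormula.realize_not, realize_atomXY,
    realize_atomYX, below, and_assoc]

theorem realize_withDir_bwd (T : L.Relations 2) (ψ : L.BoundedFormula Empty 2) (a b : A) :
    (withDir T Dir.bwd ψ).Realize default ![a, b] ↔
      below T b a ∧ ψ.Realize default ![a, b] := by
  simp only [withDir, BoundedFormula.realize_inf, BoundedFormula.realize_not, realize_atomXY,
    realize_atomYX, below]
  tauto

theorem realize_withBoth (T : L.Relations 2) (ψ : L.BoundedFormula Empty 2) (a b : A) :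
    (withBoth T ψ).Realize default ![a, b] ↔
      rel T a b ∧ rel T b a ∧ ψ.Realize default ![a, b] := by
  simp only [withBoth, BoundedFormula.realize_inf, realize_atomXY, realize_atomYX]

end Diagrams

/-! ### Assembling a structure from 2-types -/

section Assembly

open FirstOrder.Language.Structure

/-- A structure assembled from 2-types of a given structure: every pair of distinct elements
receives the 2-type of some admissible pair. -/
theorem exists_structure_of_pairs {L : FirstOrder.Language.{u, v}} [L.IsRelational]
    (hσ : ∀ n : ℕ, Nonempty (L.Relations n) → n = 1 ∨ n = 2)
    {M : Type*} [L.Structure M] {U : Type*} (f : U → M) (ok : U → U → M → M → Prop)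
    (h : ∀ u v, u ≠ v → ∃ a b, a ≠ b ∧ oneType L a = oneType L (f u) ∧
      oneType L b = oneType L (f v) ∧ ok u v a b ∧ ok v u b a) :
    ∃ _ : L.Structure U,
      (∀ u v : U, u ≠ v → ∃ a b, a ≠ b ∧ oneType L a = oneType L (f u) ∧
        oneType L b = oneType L (f v) ∧ ok u v a b ∧ ok v u b a ∧
        pairType L u v = pairType L a b) ∧
      ∀ u : U, oneType L u = oneType L (f u) := by
  classical
  -- The order only selects one of the two choices available for an unordered pair, so that `P u v`
  -- and `P v u` come from the same one.
  let : LinearOrder U := IsWellOrder.linearOrder WellOrderingRel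
  choose p q hpq using h
  let P : U → U → M := fun u v => if h : u = v then f u else if u < v then p u v h else q v u (Ne.symm h)
  have hP : ∀ u v, u ≠ v → P u v ≠ P v u ∧ oneType L (P u v) = oneType L (f u) ∧
      ok u v (P u v) (P v u) := by
    intro u v huv
    rcases lt_or_gt_of_ne huv with hlt | hlt
    · have h1 : P u v = p u v huv := by simp [P, huv, hlt]
      have h2 : P v u = q u v huv := by simp [P, huv.symm, hlt.not_gt]
      rw [h1, h2]
      exact ⟨(hpq u v huv).1, (hpq u v huv).2.1, (hpq u v huv).2.2.2.1⟩
    · have h1 : P u v = q v u huv.symm := by simp [P, huv, hlt.not_gt]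
      have h2 : P v u = p v u huv.symm := by simp [P, huv.symm, hlt]
      rw [h1, h2]
      exact ⟨(hpq v u huv.symm).1.symm, (hpq v u huv.symm).2.2.1, (hpq v u huv.symm).2.2.2.2⟩
  have hP1 : ∀ u v, oneType L (P u v) = oneType L (f u) := by
    intro u v
    by_cases huv : u = v
    · simp [P, huv]
    · exact (hP u v huv).2.1
  let S : L.Structure U :=
    { funMap := fun g => isEmptyElim g
      RelMap := fun {n} R x => match n, R, x with
        | 1, R, x => RelMap R ![f (x 0)]
        | 2, R, x => RelMap R ![P (x 0) (x 1), P (x 1) (x 0)]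
        -- By `hσ` no symbol has another arity.
        | _, _, _ => False }
  have hone : ∀ u : U, oneType L u = oneType L (f u) := by
    intro u
    ext ⟨n, R⟩
    rcases hσ n ⟨R⟩ with rfl | rfl
    · change RelMap R ![f u] ↔ RelMap R (fun _ => f u)
      have : (![f u] : Fin 1 → M) = fun _ => f u := by ext i; fin_cases i; rfl
      rw [this]
    · change RelMap R ![P u u, P u u] ↔ RelMap R (fun _ => f u)
      have : (![P u u, P u u] : Fin 2 → M) = fun _ => f u := by
        ext i; fin_cases i <;> simp [P]
      rw [this]
  have hpair : ∀ u v : U, pairType L u v = pairType L (P u v) (P v u) := by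
    intro u v
    have hu := pairType_self_iff.2 ((hone u).trans (hP1 u v).symm)
    have hv := pairType_self_iff.2 ((hone v).trans (hP1 v u).symm)
    ext ⟨⟨n, R⟩, g⟩
    -- Atoms that mention only one of the two variables are decided by the 1-types; what remains is
    -- a binary symbol with distinct arguments.
    by_cases h0 : ∀ i, g i = 0
    · change RelMap R (![u, v] ∘ g) ↔ RelMap R (![P u v, P v u] ∘ g)
      rw [comp_pair_zero u v h0, comp_pair_zero (P u v) (P v u) h0]
      exact Set.ext_iff.1 hu ⟨⟨n, R⟩, g⟩
    by_cases h1 : ∀ i, g i = 1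
    · change RelMap R (![u, v] ∘ g) ↔ RelMap R (![P u v, P v u] ∘ g)
      rw [comp_pair_one u v h1, comp_pair_one (P u v) (P v u) h1]
      exact Set.ext_iff.1 hv ⟨⟨n, R⟩, g⟩
    rcases hσ n ⟨R⟩ with rfl | rfl
    · simp only [Fin.forall_fin_one] at h0 h1
      omega
    · simp only [Fin.forall_fin_two] at h0 h1
      change RelMap R ![P (![u, v] (g 0)) (![u, v] (g 1)), P (![u, v] (g 1)) (![u, v] (g 0))] ↔
        RelMap R (![P u v, P v u] ∘ g)
      have : (![P (![u, v] (g 0)) (![u, v] (g 1)), P (![u, v] (g 1)) (![u, v] (g 0))]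
          : Fin 2 → M) = ![P u v, P v u] ∘ g := by
        have hg : g 0 = 0 ∧ g 1 = 1 ∨ g 0 = 1 ∧ g 1 = 0 := by omega
        rcases hg with ⟨ha, hb⟩ | ⟨ha, hb⟩ <;> ext i <;> fin_cases i <;> simp [ha, hb]
      rw [this]
  refine ⟨S, fun u v huv => ⟨P u v, P v u, (hP u v huv).1, hP1 u v, hP1 v u, (hP u v huv).2.2,
    (hP v u huv.symm).2.2, hpair u v⟩, hone⟩

end Assembly

/-! ### Cliques as classes of `near`, and the order between them -/

section Cliques

variable {L : FirstOrder.Language.{u, v}} (T : L.Relations 2) {A : Type*} [L.Structure A]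

/-- `a` and `b` lie in the same clique. -/
def near (a b : A) : Prop := a = b ∨ rel T a b ∧ rel T b a

variable {T} in
theorem near_refl (a : A) : near T a a := Or.inl rfl

variable {T}

theorem near.symm {a b : A} (h : near T a b) : near T b a :=
  h.imp Eq.symm And.symm

theorem near.trans (hT : ∀ a b c : A, rel T a b → rel T b c → rel T a c) {a b c : A}
    (h : near T a b) (h' : near T b c) : near T a c := by
  rcases h with rfl | h
  · exact h'
  rcases h' with rfl | h'
  · exact Or.inr h
  exact Or.inr ⟨hT _ _ _ h.1 h'.1, hT _ _ _ h'.2 h.2⟩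

/-- The relation `T` between elements of distinct cliques only depends on the cliques. -/
theorem rel_of_near (hT : ∀ a b c : A, rel T a b → rel T b c → rel T a c) {a b c d : A}
    (h : rel T a b) (hac : near T a c) (hbd : near T b d) (hcd : c ≠ d) : rel T c d := by
  rcases hac with rfl | hac <;> rcases hbd with rfl | hbd
  · exact h
  · exact hT _ _ _ h hbd.1
  · exact hT _ _ _ hac.2 h
  · exact hT _ _ _ hac.2 (hT _ _ _ h hbd.1)

theorem not_near_of_below {a b : A} (h : below T a b) : ¬ near T a b := by
  rintro (rfl | h')
  · exact h.2 h.1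
  · exact h.2 h'.2

theorem ne_of_not_near {a b : A} (h : ¬ near T a b) : a ≠ b := fun h' => h (Or.inl h')

theorem below_of_near (hT : ∀ a b c : A, rel T a b → rel T b c → rel T a c) {a b c d : A}
    (h : below T a b) (hac : near T a c) (hbd : near T b d) : below T c d := by
  have hcd : ¬ near T c d := fun h' =>
    not_near_of_below h ((hac.trans hT h').trans hT hbd.symm)
  refine ⟨rel_of_near hT h.1 hac hbd (ne_of_not_near hcd), fun h' => ?_⟩
  exact h.2 (rel_of_near hT h' hbd.symm hac.symm (ne_of_not_near (not_near_of_below h)).symm)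

theorem below.trans (hT : ∀ a b c : A, rel T a b → rel T b c → rel T a c) {a b c : A}
    (h : below T a b) (h' : below T b c) : below T a c :=
  ⟨hT _ _ _ h.1 h'.1, fun h'' => h.2 (hT _ _ _ h'.1 h'')⟩

variable (T) in
/-- The clique of an element. -/
def cliqueOf (a : A) : Set A := {b | near T a b}

theorem mem_cliqueOf_self (a : A) : a ∈ cliqueOf T a := near_refl a

theorem cliqueOf_eq_iff (hT : ∀ a b c : A, rel T a b → rel T b c → rel T a c) {a b : A} :
    cliqueOf T a = cliqueOf T b ↔ near T a b := by
  constructor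
  · intro h
    have : b ∈ cliqueOf T a := h ▸ mem_cliqueOf_self b
    exact this
  · intro h
    ext c
    exact ⟨fun hc => h.symm.trans hT hc, fun hc => h.trans hT hc⟩

theorem isClique_iff [Nonempty A] (hT : ∀ a b c : A, rel T a b → rel T b c → rel T a c)
    {B : Set A} : IsClique T B ↔ ∃ a, B = cliqueOf T a := by
  have hcon : ∀ a : A, TConnected T (cliqueOf T a) := by
    intro a b hb c hc hbc
    exact (near.trans hT (near.symm hb) hc).resolve_left hbc
  have hsub : ∀ {B : Set A} {a}, TConnected T B → a ∈ B → B ⊆ cliqueOf T a := by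
    intro B a hB ha b hb
    by_cases hab : a = b
    · exact Or.inl hab
    · exact Or.inr (hB ha hb hab)
  constructor
  · intro h
    have hne : B.Nonempty := by
      by_contra hB
      rw [Set.not_nonempty_iff_eq_empty] at hB
      obtain ⟨a⟩ := ‹Nonempty A›
      have := h.2 (hcon a) (by simp [hB]) (mem_cliqueOf_self a)
      simp [hB] at this
    obtain ⟨a, ha⟩ := hne
    exact ⟨a, (h.eq_of_subset (hcon a) (hsub h.1 ha))⟩
  · rintro ⟨a, rfl⟩
    exact ⟨hcon a, fun C hC hle => hsub hC (hle (mem_cliqueOf_self a))⟩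

theorem inTypes_cliqueOf (hT : ∀ a b c : A, rel T a b → rel T b c → rel T a c) (a : A) :
    inTypes T (cliqueOf T a) = {t | ∃ b, below T b a ∧ oneType L b = t} := by
  ext t
  constructor
  · rintro ⟨b, hb, rfl⟩
    exact ⟨b, hb a (mem_cliqueOf_self a), rfl⟩
  · rintro ⟨b, hb, rfl⟩
    exact ⟨b, fun c hc => below_of_near hT hb (near_refl b) hc, rfl⟩

theorem outTypes_cliqueOf (hT : ∀ a b c : A, rel T a b → rel T b c → rel T a c) (a : A) :
    outTypes T (cliqueOf T a) = {t | ∃ b, below T a b ∧ oneType L b = t} := by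
  ext t
  constructor
  · rintro ⟨b, hb, rfl⟩
    exact ⟨b, hb a (mem_cliqueOf_self a), rfl⟩
  · rintro ⟨b, hb, rfl⟩
    exact ⟨b, fun c hc => below_of_near hT hb hc (near_refl b), rfl⟩

/-- If `T` agrees off the diagonal with a transitive relation, and holds on the diagonal wherever
that is forced, then it is transitive. -/
theorem trans_of_le {le : A → A → Prop} (hle : ∀ a b c, le a b → le b c → le a c)
    (h : ∀ a b : A, a ≠ b → (rel T a b ↔ le a b)) (hs : ∀ a b : A, a ≠ b → rel T a b → rel T b a →
      rel T a a) (a b c : A) (hab : rel T a b) (hbc : rel T b c) : rel T a c := by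
  by_cases h1 : a = b
  · exact h1 ▸ hbc
  by_cases h2 : b = c
  · exact h2 ▸ hab
  by_cases h3 : a = c
  · subst h3
    exact hs a b h1 hab hbc
  exact (h a c h3).2 (hle _ _ _ ((h a b h1).1 hab) ((h b c h2).1 hbc))

end Cliques

/-! ### Counting by codes -/

section Counting

/-- Coding by a relation lets one element have several codes; it is enough that a code determines
its element. -/
theorem encard_le_of_code {α β : Type*} [Finite β] {S : Set α} (R : α → β → Prop)
    (h1 : ∀ x ∈ S, ∃ t, R x t) (h2 : ∀ x ∈ S, ∀ y ∈ S, ∀ t, R x t → R y t → x = y) :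
    S.encard ≤ (Nat.card β : ℕ∞) := by
  have h1' : ∀ x : S, ∃ t, R x t := fun x => h1 x x.2
  choose f hf using h1'
  have hinj : Function.Injective f := by
    intro x y hxy
    exact Subtype.ext (h2 x x.2 y y.2 (f x) (hf x) (hxy ▸ hf y))
  rw [← ENat.card_eq_coe_natCard]
  exact ENat.card_le_card_of_injective hinj

variable {L : FirstOrder.Language.{u, v}} [Finite (Σ n, L.Relations n)]

theorem card_code_le (hσ : ∀ n : ℕ, Nonempty (L.Relations n) → n = 1 ∨ n = 2) (k : ℕ)
    (hk : 0 < k) : Nat.card (Code L k) ≤ sigSize L * k ^ 2 := by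
  have := Fintype.ofFinite (Σ n, L.Relations n)
  rw [Nat.card_sigma]
  calc ∑ R : (Σ n, L.Relations n), Nat.card (Fin R.1 → Fin k)
      ≤ ∑ R : (Σ n, L.Relations n), k ^ 2 := by
        refine Finset.sum_le_sum fun R _ => ?_
        rw [Nat.card_fun, Nat.card_fin, Nat.card_fin]
        refine Nat.pow_le_pow_right hk ?_
        rcases hσ R.1 ⟨R.2⟩ with h | h <;> omega
    _ = sigSize L * k ^ 2 := by simp [sigSize]

theorem one_le_sigSize (T : L.Relations 2) : 1 ≤ sigSize L := by
  have : Nonempty (Σ n, L.Relations n) := ⟨⟨2, T⟩⟩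
  exact Nat.card_pos

theorem card_set_code_le (hσ : ∀ n : ℕ, Nonempty (L.Relations n) → n = 1 ∨ n = 2) (k : ℕ)
    (hk : 0 < k) : Nat.card (Set (Code L k)) ≤ 2 ^ (sigSize L * k ^ 2) := by
  have h : Nat.card (Set (Code L k)) = 2 ^ Nat.card (Code L k) := by
    change Nat.card (Code L k → Prop) = _
    rw [Nat.card_fun]
    simp
  rw [h]
  exact Nat.pow_le_pow_right two_pos (card_code_le hσ k hk)

end Counting
-- Models with small cliques
section SmallCliques

variable {L : FirstOrder.Language.{u, v}} {T : L.Relations 2} {M : Type w} [L.Structure M]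

theorem realize_psi0_of_pairs [L.IsRelational] {Ψ : NormalForm L} {U : Type*} [L.Structure U]
    {f : U → M} (hM : IsModel T Ψ M)
    (h1 : ∀ u : U, oneType L u = oneType L (f u))
    (h2 : ∀ u v : U, u ≠ v → ∃ a b : M, a ≠ b ∧ pairType L u v = pairType L a b) (u v : U) :
    Ψ.psi0.1.Realize default ![u, v] := by
  have hM0 := ((isModel_iff T Ψ).1 hM).2.2.1
  by_cases huv : u = v
  · subst huv
    exact (realize_congr Ψ.psi0.2 (pairType_self_iff.2 (h1 u)) (by simp)).2 (hM0 _ _)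
  · obtain ⟨a, b, hab, h⟩ := h2 u v huv
    exact (realize_congr Ψ.psi0.2 h (by simp [hab, huv])).2 (hM0 _ _)

/-- A structure all of whose 2-types are realized in a model, and whose elements realize all the
2-types that the corresponding elements of the model realize, is a model. -/
theorem isModel_of_rich [L.IsRelational] {Ψ : NormalForm L} {U : Type*} [L.Structure U]
    [Nonempty U] {f : U → M} (hM : IsModel T Ψ M)
    (h1 : ∀ u : U, oneType L u = oneType L (f u))
    (h2 : ∀ u v : U, u ≠ v → ∃ a b : M, a ≠ b ∧ pairType L u v = pairType L a b)
    (h3 : ∀ (u : U) (b : M), b ≠ f u → ∃ v, u ≠ v ∧ pairType L u v = pairType L (f u) b)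
    (hT : ∀ a b c : U, rel T a b → rel T b c → rel T a c) : IsModel T Ψ U := by
  have hM' := (isModel_iff T Ψ).1 hM
  have key : ∀ φ : L.BoundedFormula Empty 2, φ.IsQF →
      (∀ a : M, ∃ b, φ.Realize default ![a, b]) → ∀ u : U, ∃ v, φ.Realize default ![u, v] := by
    intro φ hφ h u
    obtain ⟨b, hb⟩ := h (f u)
    by_cases hbu : b = f u
    · refine ⟨u, (realize_congr hφ (pairType_self_iff.2 (h1 u)) (by simp)).2 (hbu ▸ hb)⟩
    · obtain ⟨v, huv, hv⟩ := h3 u b hbu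
      exact ⟨v, (realize_congr hφ hv (by simp [huv, Ne.symm hbu])).2 hb⟩
  exact (isModel_iff T Ψ).2 ⟨inferInstance, hT, realize_psi0_of_pairs hM h1 h2,
    fun i => key _ (withDir_isQF T _ (Ψ.gammaPsi i).2) (hM'.2.2.2.1 i),
    fun i => key _ (withBoth_isQF T (Ψ.deltaPsi i).2) (hM'.2.2.2.2 i)⟩

variable (T) in
/-- `a` and `b` have the same 1-type and lie in the same clique. -/
def twin (a b : M) : Prop := near T a b ∧ oneType L a = oneType L b

theorem twin.symm {a b : M} (h : twin T a b) : twin T b a := ⟨h.1.symm, h.2.symm⟩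

theorem twin.trans (hT : ∀ a b c : M, rel T a b → rel T b c → rel T a c) {a b c : M}
    (h : twin T a b) (h' : twin T b c) : twin T a c := ⟨h.1.trans hT h'.1, h.2.trans h'.2⟩

theorem twin_refl (a : M) : twin T a a := ⟨near_refl a, rfl⟩

variable (T) in
/-- `a` is the only element of its clique with its 1-type. -/
def IsKing (a : M) : Prop := ∀ b, twin T a b → b = a

/-- Choices made in a structure: representatives of the classes of twins, and witnesses for
2-types, in the whole structure or in a given class of twins. -/
structure Choices (T : L.Relations 2) (M : Type w) [L.Structure M] where
  rep : M → M
  twin_rep : ∀ a, twin T a (rep a)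
  rep_eq : ∀ a b, twin T a b → rep a = rep b
  wit : M → Set (Code L 2) → M
  wit_spec : ∀ a b, b ≠ a → wit a (pairType L a b) ≠ a ∧
    pairType L a (wit a (pairType L a b)) = pairType L a b
  witIn : M → Set (Code L 2) → M → M
  twin_witIn : ∀ c τ r, twin T r (witIn c τ r)
  witIn_spec : ∀ c b r, twin T r b → b ≠ c →
    witIn c (pairType L c b) r ≠ c ∧ pairType L c (witIn c (pairType L c b) r) = pairType L c b

theorem nonempty_choices (hT : ∀ a b c : M, rel T a b → rel T b c → rel T a c) :
    Nonempty (Choices T M) := by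
  classical
  let S : Setoid M := ⟨twin T, twin_refl, twin.symm, twin.trans hT⟩
  have h1 : ∀ (a : M) (τ : Set (Code L 2)), ∃ c : M,
      (∃ b, b ≠ a ∧ pairType L a b = τ) → c ≠ a ∧ pairType L a c = τ := by
    intro a τ
    by_cases h : ∃ b, b ≠ a ∧ pairType L a b = τ
    · exact ⟨h.choose, fun _ => h.choose_spec⟩
    · exact ⟨a, fun h' => absurd h' h⟩
  have h2 : ∀ (c : M) (τ : Set (Code L 2)) (r : M), ∃ d : M, twin T r d ∧
      ((∃ b, twin T r b ∧ b ≠ c ∧ pairType L c b = τ) → d ≠ c ∧ pairType L c d = τ) := by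
    intro c τ r
    by_cases h : ∃ b, twin T r b ∧ b ≠ c ∧ pairType L c b = τ
    · exact ⟨h.choose, h.choose_spec.1, fun _ => h.choose_spec.2⟩
    -- The default `r` makes `twin_witIn` hold even for unrealized 2-types; the size bound on the
    -- court relies on this.
    · exact ⟨r, twin_refl r, fun h' => absurd h' h⟩
  choose g hg using h1
  choose w hw hw' using h2
  exact ⟨{
    rep := fun a => (Quotient.mk S a).out
    twin_rep := fun a => twin.symm (Quotient.mk_out (s := S) a)
    rep_eq := fun a b h => by rw [Quotient.sound (s := S) h]
    wit := g
    wit_spec := fun a b hb => hg a _ ⟨b, hb, rfl⟩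
    witIn := w
    twin_witIn := hw
    witIn_spec := fun c b r h hb => hw' c _ r ⟨b, h, hb, rfl⟩ }⟩

namespace Choices

variable (C : Choices T M)

/-- Elements whose connection to the copies of the representative `r` is kept. -/
def kept (r : M) : Set M := {c | c ≠ r ∧ ∃ τ, c = C.wit r τ}

/-- The kings and their court. -/
def court : Set M :=
  {a | IsKing T a ∨ ∃ r c τ, C.rep r = r ∧ c ∈ C.kept r ∧ a = C.witIn c τ r}

/-- The representatives of which copies are used. -/
def reps : Set M := {r | ¬ IsKing T r ∧ C.rep r = r}

theorem rep_mem_reps (hT : ∀ a b c : M, rel T a b → rel T b c → rel T a c) {a : M}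
    (ha : ¬ IsKing T a) : C.rep a ∈ C.reps := by
  refine ⟨fun hk => ha ?_, C.rep_eq _ _ (C.twin_rep a).symm⟩
  intro b hab
  have h1 := hk a (C.twin_rep a).symm
  have h2 := hk b ((C.twin_rep a).symm.trans hT hab)
  rw [h2, ← h1]

/-- The universe of the structure with small cliques. -/
abbrev Univ (N : ℕ) : Type w := C.court ⊕ (C.reps × Fin N × Fin 3)

/-- The element of the given structure to which an element of the new one corresponds. -/
def proj {N : ℕ} : C.Univ N → M
  | Sum.inl a => a
  | Sum.inr x => x.1

/-- The requirements on the 2-type of a pair of elements. -/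
def demand {N : ℕ} (e : Set (Code L 2) ≃ Fin N) : C.Univ N → C.Univ N → M → M → Prop
  | Sum.inl a, Sum.inl b, x, y => pairType L x y = pairType L (a : M) (b : M)
  | Sum.inr r, Sum.inl c, x, y =>
      (c : M) ∈ C.kept r.1 → pairType L x y = pairType L (r.1 : M) (c : M)
  | Sum.inl c, Sum.inr r, x, y => (c : M) ∉ C.kept r.1 → r.2.2 = 0 →
      (∃ b, twin T (r.1 : M) b ∧ b ≠ c ∧ pairType L (c : M) b = e.symm r.2.1) →
        pairType L x y = e.symm r.2.1
  | Sum.inr r, Sum.inr s, x, y => s.2.2 = r.2.2 + 1 →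
      (∃ b, twin T (s.1 : M) b ∧ b ≠ r.1 ∧ pairType L (r.1 : M) b = e.symm s.2.1) →
        pairType L x y = e.symm s.2.1

theorem exists_twin_ne {r : M} (hr : r ∈ C.reps) (c : M) : ∃ b, twin T r b ∧ b ≠ c := by
  by_cases h : r = c
  · have := hr.1
    simp only [IsKing, not_forall] at this
    obtain ⟨b, hb, hne⟩ := this
    exact ⟨b, hb, h ▸ hne⟩
  · exact ⟨r, twin_refl r, h⟩

/-- The two demands exclude each other, one applying when `c` is kept for `r` and the other when it
is not. Each is met by `c` and a suitable twin of `r`. -/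
theorem exists_pair_court_rep {N : ℕ}
    (e : Set (Code L 2) ≃ Fin N) (c : C.court) (r : C.reps × Fin N × Fin 3) :
    ∃ a b, a ≠ b ∧ twin T (c : M) a ∧ twin T (r.1 : M) b ∧
      C.demand e (Sum.inl c) (Sum.inr r) a b ∧ C.demand e (Sum.inr r) (Sum.inl c) b a := by
  by_cases h1 : (c : M) ∈ C.kept r.1
  · exact ⟨c, r.1, h1.1, twin_refl _, twin_refl _, fun h => absurd h1 h, fun _ => rfl⟩
  by_cases h2 : ∃ b, twin T (r.1 : M) b ∧ b ≠ c ∧ pairType L (c : M) b = e.symm r.2.1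
  · obtain ⟨b, hb, hbc, hτ⟩ := h2
    exact ⟨c, b, hbc.symm, twin_refl _, hb, fun _ _ _ => hτ, fun h => absurd h h1⟩
  · obtain ⟨b, hb, hbc⟩ := C.exists_twin_ne r.1.2 c
    exact ⟨c, b, hbc.symm, twin_refl _, hb, fun _ _ h => absurd h h2, fun h => absurd h h1⟩

/-- The layer condition silences the demand of `s` on `r`, which leaves at most one demand. -/
theorem exists_pair_rep_rep {N : ℕ}
    (e : Set (Code L 2) ≃ Fin N) (r s : C.reps × Fin N × Fin 3) (hrs : r.2.2 ≠ s.2.2 + 1) :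
    ∃ a b, a ≠ b ∧ twin T (r.1 : M) a ∧ twin T (s.1 : M) b ∧
      C.demand e (Sum.inr r) (Sum.inr s) a b ∧ C.demand e (Sum.inr s) (Sum.inr r) b a := by
  by_cases h2 : ∃ b, twin T (s.1 : M) b ∧ b ≠ r.1 ∧ pairType L (r.1 : M) b = e.symm s.2.1
  · obtain ⟨b, hb, hbc, hτ⟩ := h2
    exact ⟨r.1, b, hbc.symm, twin_refl _, hb, fun _ _ => hτ, fun h => absurd h hrs⟩
  · obtain ⟨b, hb, hbc⟩ := C.exists_twin_ne s.1.2 r.1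
    exact ⟨r.1, b, hbc.symm, twin_refl _, hb, fun _ h => absurd h h2, fun h => absurd h hrs⟩

theorem exists_pair {N : ℕ}
    (e : Set (Code L 2) ≃ Fin N) (u v : C.Univ N) (huv : u ≠ v) :
    ∃ a b, a ≠ b ∧ twin T (C.proj u) a ∧ twin T (C.proj v) b ∧
      C.demand e u v a b ∧ C.demand e v u b a := by
  rcases u with a | r <;> rcases v with b | s
  · refine ⟨a, b, fun h => huv ?_, twin_refl _, twin_refl _, rfl, rfl⟩
    rw [Subtype.ext h]
  · exact C.exists_pair_court_rep e a s
  · obtain ⟨x, y, h1, h2, h3, h4, h5⟩ := C.exists_pair_court_rep e b r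
    exact ⟨y, x, h1.symm, h3, h2, h5, h4⟩
  -- In `Fin 3` two layers cannot each be the successor of the other.
  · by_cases hrs : r.2.2 = s.2.2 + 1
    · have hsr : s.2.2 ≠ r.2.2 + 1 := by
        intro h
        rw [h] at hrs
        revert hrs
        generalize r.2.2 = i
        revert i
        decide
      obtain ⟨x, y, h1, h2, h3, h4, h5⟩ := C.exists_pair_rep_rep e s r hsr
      exact ⟨y, x, h1.symm, h3, h2, h5, h4⟩
    · exact C.exists_pair_rep_rep e r s hrs

/-- Every 2-type realized at `C.proj u` is demanded at `u`. -/
theorem exists_demand (hT : ∀ a b c : M, rel T a b → rel T b c → rel T a c) {N : ℕ}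
    (e : Set (Code L 2) ≃ Fin N) (u : C.Univ N) (b : M) (hb : b ≠ C.proj u) :
    ∃ v, u ≠ v ∧ ∀ x y, C.demand e u v x y → pairType L x y = pairType L (C.proj u) b := by
  rcases u with a | r
  · change b ≠ a at hb
    change ∃ v, _ ∧ ∀ x y, _ → pairType L x y = pairType L (a : M) b
    by_cases hbO : b ∈ C.court
    · refine ⟨Sum.inl ⟨b, hbO⟩, fun h => hb ?_, fun x y h => h⟩
      exact (congrArg C.proj h).symm
    · have hbk : ¬ IsKing T b := fun h => hbO (Or.inl h)
      have hr := C.rep_mem_reps hT hbk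
      -- If `a` is kept, its 2-types to copies of this representative are already fixed; the court
      -- contains a twin of `b` for exactly this case.
      by_cases hk : (a : M) ∈ C.kept (C.rep b)
      · obtain ⟨h1, h2⟩ := C.witIn_spec a b (C.rep b) (C.twin_rep b).symm hb
        refine ⟨Sum.inl ⟨C.witIn a (pairType L (a : M) b) (C.rep b),
          Or.inr ⟨_, _, _, hr.2, hk, rfl⟩⟩, fun h => h1 ?_, fun x y h => h.trans h2⟩
        exact (congrArg C.proj h).symm
      · refine ⟨Sum.inr (⟨_, hr⟩, e (pairType L (a : M) b), 0), by simp, fun x y h => ?_⟩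
        simpa using h hk rfl ⟨b, (C.twin_rep b).symm, hb, by simp⟩
  · change b ≠ r.1 at hb
    change ∃ v, _ ∧ ∀ x y, _ → pairType L x y = pairType L (r.1 : M) b
    obtain ⟨h1, h2⟩ := C.wit_spec r.1 b hb
    generalize hc : C.wit r.1 (pairType L (r.1 : M) b) = c at h1 h2
    by_cases hcO : c ∈ C.court
    · exact ⟨Sum.inl ⟨c, hcO⟩, by simp, fun x y h => (h ⟨h1, _, hc.symm⟩).trans h2⟩
    · have hck : ¬ IsKing T c := fun h => hcO (Or.inl h)
      refine ⟨Sum.inr (⟨_, C.rep_mem_reps hT hck⟩, e (pairType L (r.1 : M) b), r.2.2 + 1),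
        fun h => ?_, fun x y h => ?_⟩
      · have := congrArg (fun x : C.reps × Fin N × Fin 3 => x.2.2) (Sum.inr.inj h)
        revert this
        simp
      · simpa using h rfl ⟨c, (C.twin_rep c).symm, h1, by simp [h2]⟩

/-- A bound on the size of the part of the new universe lying over one clique. -/
theorem encard_fiber_le [Finite (Σ n, L.Relations n)]
    (hT : ∀ a b c : M, rel T a b → rel T b c → rel T a c) {N : ℕ}
    (e : Set (Code L 2) ≃ Fin N) (a : M) :
    {v : C.Univ N | near T a (C.proj v)}.encard ≤ ((N + N ^ 3 + N * (N * 3) : ℕ) : ℕ∞) := by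
  -- Within one clique a 1-type determines a king or a representative. Any other court element is
  -- `witIn c τ' r` with `c = wit r τ`, hence fixed by the 1-type of `r` and two 2-types.
  let R : C.Univ N → (Fin N ⊕ Fin N × Fin N × Fin N) ⊕ Fin N × Fin N × Fin 3 → Prop
    | Sum.inl b, Sum.inl (Sum.inl τ) => IsKing T (b : M) ∧ e (pairType L (b : M) b) = τ
    | Sum.inl b, Sum.inl (Sum.inr (ρ, τ, τ')) => ∃ r, C.rep r = r ∧ e (pairType L r r) = ρ ∧
        (b : M) = C.witIn (C.wit r (e.symm τ)) (e.symm τ') r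
    | Sum.inr r, Sum.inr (ρ, κ, k) => e (pairType L (r.1 : M) r.1) = ρ ∧ r.2.1 = κ ∧ r.2.2 = k
    | _, _ => False
  have htwin : ∀ {x y : M}, near T a x → near T a y →
      e (pairType L x x) = e (pairType L y y) → twin T x y := fun hx hy h =>
    ⟨hx.symm.trans hT hy, pairType_self_iff.1 (e.injective h)⟩
  have hrep : ∀ {x y : M}, near T a x → near T a y → C.rep x = x → C.rep y = y →
      e (pairType L x x) = e (pairType L y y) → x = y := fun hx hy hx' hy' h => by
    rw [← hx', ← hy', C.rep_eq _ _ (htwin hx hy h)]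
  have hcard : Nat.card ((Fin N ⊕ Fin N × Fin N × Fin N) ⊕ Fin N × Fin N × Fin 3) =
      N + N ^ 3 + N * (N * 3) := by
    simp only [Nat.card_sum, Nat.card_prod, Nat.card_fin]
    ring
  rw [← hcard]
  refine encard_le_of_code R ?_ ?_
  · rintro (⟨b, hb⟩ | ⟨r, κ, k⟩) -
    · rcases hb with hb | ⟨r, c, τ', hr, ⟨-, τ, rfl⟩, rfl⟩
      · exact ⟨Sum.inl (Sum.inl _), hb, rfl⟩
      · exact ⟨Sum.inl (Sum.inr (e (pairType L r r), e τ, e τ')), r, hr, rfl, by simp⟩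
    · exact ⟨Sum.inr (_, _, _), rfl, rfl, rfl⟩
  · rintro (b | ⟨r, κ, k⟩) hx (b' | ⟨r', κ', k'⟩) hy ((τ | ⟨ρ, τ, τ'⟩) | ⟨ρ, κ'', k''⟩) h h'
    all_goals first | exact h.elim | exact h'.elim | skip
    · exact congrArg Sum.inl (Subtype.ext (h'.1 b (htwin hy hx (h'.2.trans h.2.symm))))
    · obtain ⟨r, hr, hρ, hb⟩ := h
      obtain ⟨r', hr', hρ', hb'⟩ := h'
      have h1 : near T a r := near.trans hT (show near T a b from hx) (hb ▸ (C.twin_witIn _ _ r).symm.1)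
      have h2 : near T a r' := near.trans hT (show near T a b' from hy)
        (hb' ▸ (C.twin_witIn _ _ r').symm.1)
      obtain rfl := hrep h1 h2 hr hr' (hρ.trans hρ'.symm)
      exact congrArg Sum.inl (Subtype.ext (hb.trans hb'.symm))
    · obtain ⟨h1, h2, h3⟩ := h
      obtain ⟨h1', h2', h3'⟩ := h'
      have : r = r' := Subtype.ext (hrep hx hy r.2.2 r'.2.2 (h1.trans h1'.symm))
      simp only at h2 h3 h2' h3'
      rw [this, h2, h3, h2', h3']

end Choices

/-- Every satisfiable sentence has a model in which all cliques are small. -/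
theorem exists_model_small_cliques [L.IsRelational] [Finite (Σ n, L.Relations n)]
    (hσ : ∀ n : ℕ, Nonempty (L.Relations n) → n = 1 ∨ n = 2) {Ψ : NormalForm L}
    (hM : IsModel T Ψ M) :
    ∃ (A : Type w) (_ : L.Structure A), IsModel T Ψ A ∧
      ∀ a : A, (cliqueOf T a).encard ≤ ((2 ^ (15 * sigSize L) : ℕ) : ℕ∞) := by
  have hT := hM.2.1
  obtain ⟨C⟩ := nonempty_choices hT
  obtain ⟨N, ⟨e⟩⟩ := Finite.exists_equiv_fin (Set (Code L 2))
  have hN := card_set_code_le hσ 2 two_pos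
  rw [Nat.card_congr e, Nat.card_fin] at hN
  obtain ⟨_, h2, h1⟩ := exists_structure_of_pairs hσ C.proj
    (fun u v a b => near T (C.proj u) a ∧ C.demand e u v a b) (fun u v huv => by
      obtain ⟨a, b, hab, ha, hb, h, h'⟩ := C.exists_pair e u v huv
      exact ⟨a, b, hab, ha.2.symm, hb.2.symm, ⟨ha.1, h⟩, hb.1, h'⟩)
  have hrel : ∀ u v : C.Univ N, u ≠ v →
      (rel T u v ↔ C.proj u = C.proj v ∨ rel T (C.proj u) (C.proj v)) := by
    intro u v huv
    obtain ⟨a, b, hab, -, -, ⟨ha, -⟩, ⟨hb, -⟩, h⟩ := h2 u v huv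
    rw [rel_congr T h]
    by_cases huv' : C.proj u = C.proj v
    · simp only [huv', true_or, iff_true]
      exact ((ha.symm.trans hT (huv' ▸ hb)).resolve_left hab).1
    · simp only [huv', false_or]
      exact ⟨fun h => rel_of_near hT h ha.symm hb.symm huv',
        fun h => rel_of_near hT h ha hb hab⟩
  have hself : ∀ u v : C.Univ N, u ≠ v → rel T u v → rel T v u → rel T u u := by
    intro u v huv h h'
    obtain ⟨a, b, hab, hau, -, -, -, hp⟩ := h2 u v huv
    rw [rel_congr T hp] at h
    rw [rel_congr T (pairType_swap hp)] at h'
    rw [rel_self_congr T ((h1 u).trans hau.symm)]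
    exact hT _ _ _ h h'
  have hle : ∀ a b c : C.Univ N, (C.proj a = C.proj b ∨ rel T (C.proj a) (C.proj b)) →
      (C.proj b = C.proj c ∨ rel T (C.proj b) (C.proj c)) →
      (C.proj a = C.proj c ∨ rel T (C.proj a) (C.proj c)) := by
    rintro a b c (h | h) (h' | h')
    · exact Or.inl (h.trans h')
    · exact Or.inr (h ▸ h')
    · exact Or.inr (h' ▸ h)
    · exact Or.inr (hT _ _ _ h h')
  have hTU := trans_of_le hle hrel hself
  have hne : Nonempty (C.Univ N) := by
    obtain ⟨a⟩ := hM.1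
    by_cases ha : IsKing T a
    · exact ⟨Sum.inl ⟨a, Or.inl ha⟩⟩
    · have : 0 < N := by
        have := (e ∅).2
        omega
      exact ⟨Sum.inr (⟨_, C.rep_mem_reps hT ha⟩, ⟨0, this⟩, 0)⟩
  refine ⟨C.Univ N, inferInstance, isModel_of_rich hM h1 ?_ ?_ hTU, fun a => ?_⟩
  · intro u v huv
    obtain ⟨a, b, hab, -, -, -, -, h⟩ := h2 u v huv
    exact ⟨a, b, hab, h⟩
  · intro u b hb
    obtain ⟨v, huv, hv⟩ := C.exists_demand hT e u b hb
    obtain ⟨x, y, -, -, -, ⟨-, hd⟩, -, h⟩ := h2 u v huv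
    exact ⟨v, huv, h.trans (hv x y hd)⟩
  · have hsub : cliqueOf T a ⊆ {v : C.Univ N | near T (C.proj a) (C.proj v)} := by
      rintro v (rfl | ⟨h, h'⟩)
      · exact near_refl _
      · by_cases hav : a = v
        · exact Or.inl (by rw [hav])
        · rw [hrel a v hav] at h
          rw [hrel v a (Ne.symm hav)] at h'
          rcases h with h | h
          · exact Or.inl h
          rcases h' with h' | h'
          · exact Or.inl h'.symm
          exact Or.inr ⟨h, h'⟩
    refine ((Set.encard_le_encard hsub).trans (C.encard_fiber_le hT e _)).trans ?_
    have hs := one_le_sigSize T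
    have h1N : 1 ≤ N := by
      have := (e ∅).2
      omega
    norm_cast
    -- With `N ≤ 2 ^ (4|σ|)`, the exponent is `3 + 12|σ| ≤ 15|σ|`.
    calc N + N ^ 3 + N * (N * 3) ≤ 8 * N ^ 3 := by nlinarith [Nat.pow_le_pow_left h1N 2]
      _ ≤ 2 ^ 3 * (2 ^ (sigSize L * 2 ^ 2)) ^ 3 := by gcongr; norm_num
      _ = 2 ^ (3 + sigSize L * 2 ^ 2 * 3) := by rw [pow_add, pow_mul 2 (sigSize L * 2 ^ 2) 3]
      _ ≤ 2 ^ (15 * sigSize L) := Nat.pow_le_pow_right two_pos (by omega)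

end SmallCliques
-- The number of splices
section SpliceCounting

open FirstOrder.Language.Structure

variable {L : FirstOrder.Language.{u, v}} [L.IsRelational]

theorem isoType_eq {A B : Type w} [L.Structure A] [L.Structure B] {S : Set A} {S' : Set B}
    (f : S ≃ S') (hf : ∀ (n : ℕ) (R : L.Relations n) (x : Fin n → S),
      RelMap R (fun i => (f (x i) : B)) ↔ RelMap R (fun i => (x i : A))) :
    isoType L S = isoType L S' :=
  Quotient.sound ⟨{
    toEquiv := f
    map_fun' := fun g => isEmptyElim g
    map_rel' := fun {n} R x => hf n R x }⟩

theorem isoType_range_eq {A B : Type w} [L.Structure A] [L.Structure B] {k : ℕ} {x : Fin k → A}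
    {y : Fin k → B} (hk : ∀ i j, x i = x j ↔ y i = y j) (hd : diagram L x = diagram L y) :
    isoType L (Set.range x) = isoType L (Set.range y) := by
  choose g hg using fun a : Set.range x => a.2
  choose g' hg' using fun b : Set.range y => b.2
  let f : Set.range x ≃ Set.range y :=
    { toFun := fun a => ⟨y (g a), g a, rfl⟩
      invFun := fun b => ⟨x (g' b), g' b, rfl⟩
      left_inv := fun a => Subtype.ext (((hk _ _).2 (hg' _)).trans (hg a))
      right_inv := fun b => Subtype.ext (((hk _ _).1 (hg _)).trans (hg' b)) }
  refine isoType_eq f fun n R t => ?_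
  have h := Set.ext_iff.1 hd ⟨⟨n, R⟩, g ∘ t⟩
  have ht : (fun i => (t i : A)) = x ∘ g ∘ t := funext fun i => (hg (t i)).symm
  rw [ht]
  exact h.symm

theorem exists_range_eq_of_encard_le {A : Type*} {B : Set A} (hB : B.Nonempty) {H : ℕ}
    (h : B.encard ≤ H) : ∃ x : Fin H → A, Set.range x = B := by
  have hfin : B.Finite := Set.finite_of_encard_le_coe h
  have := hfin.fintype
  have hne : Nonempty B := hB.to_subtype
  have hcard : Fintype.card B ≤ Fintype.card (Fin H) := by
    rw [← Nat.card_eq_fintype_card, Nat.card_coe_set_eq, Fintype.card_fin]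
    rw [← hfin.cast_ncard_eq] at h
    exact_mod_cast h
  obtain ⟨f⟩ := Function.Embedding.nonempty_of_card_le hcard
  refine ⟨fun i => (Function.invFun (f : B → Fin H) i : B), ?_⟩
  ext a
  constructor
  · rintro ⟨i, rfl⟩
    exact (Function.invFun (f : B → Fin H) i).2
  · intro ha
    obtain ⟨i, hi⟩ := Function.invFun_surjective f.injective ⟨a, ha⟩
    exact ⟨i, by simp [hi]⟩

/-- A clique is enumerated, with repetitions, by `Fin H`. The equality pattern and the diagram of
the enumeration give the isomorphism type. -/
theorem encard_splices_le_card [Finite (Σ n, L.Relations n)] {T : L.Relations 2} {A : Type w}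
    [L.Structure A] [Nonempty A]
    (hT : ∀ a b c : A, rel T a b → rel T b c → rel T a c) {H : ℕ}
    (hH : ∀ a : A, (cliqueOf T a).encard ≤ H) :
    (splices T A).encard ≤ (Nat.card (Set (Fin H × Fin H) × Set (Code L H) ×
      Set (Set (Σ n, L.Relations n)) × Set (Set (Σ n, L.Relations n))) : ℕ∞) := by
  refine encard_le_of_code (fun p d => ∃ x : Fin H → A, p = splice T (Set.range x) ∧
    d = ({i | x i.1 = x i.2}, diagram L x, inTypes T (Set.range x), outTypes T (Set.range x))) ?_ ?_
  · rintro p ⟨B, hB, rfl⟩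
    obtain ⟨a, rfl⟩ := (isClique_iff hT).1 hB
    obtain ⟨x, hx⟩ := exists_range_eq_of_encard_le ⟨a, mem_cliqueOf_self a⟩ (hH a)
    exact ⟨_, x, by rw [hx], rfl⟩
  · rintro p - q - d ⟨x, rfl, rfl⟩ ⟨y, rfl, h⟩
    simp only [Prod.mk.injEq] at h
    obtain ⟨h1, h2, h3, h4⟩ := h
    rw [splice, splice, isoType_range_eq (fun i j => Set.ext_iff.1 h1 (i, j)) h2, h3, h4]

theorem card_set_eq (α : Type*) [Finite α] : Nat.card (Set α) = 2 ^ Nat.card α := by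
  change Nat.card (α → Prop) = _
  rw [Nat.card_fun]
  simp

theorem encard_splices_le [Finite (Σ n, L.Relations n)]
    (hσ : ∀ n : ℕ, Nonempty (L.Relations n) → n = 1 ∨ n = 2) {T : L.Relations 2} {A : Type w}
    [L.Structure A] [Nonempty A]
    (hT : ∀ a b c : A, rel T a b → rel T b c → rel T a c)
    (hH : ∀ a : A, (cliqueOf T a).encard ≤ ((2 ^ (15 * sigSize L) : ℕ) : ℕ∞)) :
    (splices T A).encard ≤ ((2 ^ 2 ^ (40 * sigSize L) : ℕ) : ℕ∞) := by
  refine (encard_splices_le_card hT hH).trans ?_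
  have hs := one_le_sigSize T
  have hc := card_set_code_le hσ (2 ^ (15 * sigSize L)) (by positivity)
  simp only [Nat.card_prod, card_set_eq (Fin _ × Fin _), card_set_eq (Set (Σ n, L.Relations n)),
    card_set_eq (Σ n, L.Relations n), Nat.card_fin]
  change _ ≤ ((2 ^ 2 ^ (40 * sigSize L) : ℕ) : ℕ∞)
  have hn : Nat.card (Σ n, L.Relations n) = sigSize L := rfl
  rw [hn]
  generalize sigSize L = n at *
  norm_cast
  have h1 : n < 2 ^ n := Nat.lt_two_pow_self
  calc 2 ^ (2 ^ (15 * n) * 2 ^ (15 * n)) *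
        (Nat.card (Set (Code L (2 ^ (15 * n)))) * (2 ^ 2 ^ n * 2 ^ 2 ^ n))
      ≤ 2 ^ (2 ^ (15 * n) * 2 ^ (15 * n)) *
        (2 ^ (n * (2 ^ (15 * n)) ^ 2) * (2 ^ 2 ^ n * 2 ^ 2 ^ n)) := by gcongr
    _ = 2 ^ (2 ^ (30 * n) + (n * 2 ^ (30 * n) + (2 ^ n + 2 ^ n))) := by
      simp only [← pow_add, ← pow_mul]
      congr 4 <;> ring_nf
    _ ≤ 2 ^ 2 ^ (40 * n) := by
      refine Nat.pow_le_pow_right two_pos ?_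
      have h2 : 2 ^ n ≤ 2 ^ (30 * n) := Nat.pow_le_pow_right two_pos (by omega)
      have h3 : n * 2 ^ (30 * n) ≤ 2 ^ n * 2 ^ (30 * n) := Nat.mul_le_mul_right _ h1.le
      have h4 : 2 ^ (30 * n) ≤ 2 ^ n * 2 ^ (30 * n) := Nat.le_mul_of_pos_left _ (by positivity)
      calc _ ≤ 2 ^ 2 * (2 ^ n * 2 ^ (30 * n)) := by omega
        _ = 2 ^ (2 + (n + 30 * n)) := by simp only [pow_add]
        _ ≤ 2 ^ (40 * n) := Nat.pow_le_pow_right two_pos (by omega)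

end SpliceCounting
-- Which cliques may be placed above which, and which may be copied
section Reach

variable {L : FirstOrder.Language.{u, v}} {T : L.Relations 2} {M : Type w} [L.Structure M]

theorem typesOf_eq_of_isoType [L.IsRelational] {B C : Set M} (h : isoType L B = isoType L C) :
    oneType L '' B = oneType L '' C := by
  have key : ∀ {B C : Set M}, ((induced L B) ≃[L] (induced L C)) →
      oneType L '' B ⊆ oneType L '' C := by
    rintro B C e _ ⟨b, hb, rfl⟩
    refine ⟨e ⟨b, hb⟩, (e ⟨b, hb⟩).2, ?_⟩
    ext ⟨n, R⟩
    exact e.map_rel R (fun _ => ⟨b, hb⟩)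
  obtain ⟨e⟩ := Quotient.exact h
  exact (key e).antisymm (key e.symm)

variable (T) in
/-- Copies of `C` may be put above copies of `B` without changing the 1-types above and below. -/
def Reach (B C : Set M) : Prop :=
  outTypes T C ⊆ outTypes T B ∧ oneType L '' C ⊆ outTypes T B ∧
    inTypes T B ⊆ inTypes T C ∧ oneType L '' B ⊆ inTypes T C

theorem Reach.trans {B C D : Set M} (h : Reach T B C) (h' : Reach T C D) : Reach T B D :=
  ⟨h'.1.trans h.1, h'.2.1.trans h.1, h.2.2.1.trans h'.2.2.1, h.2.2.2.trans h'.2.2.1⟩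

/-- The 1-types occurring in a clique can be read off its isomorphism type, so everything in `Reach`
is part of the splices. -/
theorem reach_congr [L.IsRelational] {B B' C C' : Set M} (h : splice T B = splice T B')
    (h' : splice T C = splice T C') : Reach T B C ↔ Reach T B' C' := by
  simp only [splice, Prod.mk.injEq] at h h'
  simp only [Reach, typesOf_eq_of_isoType h.1, h.2.1, h.2.2, typesOf_eq_of_isoType h'.1, h'.2.1,
    h'.2.2]

theorem reach_of_below (hT : ∀ a b c : M, rel T a b → rel T b c → rel T a c) {a b : M}
    (h : below T a b) : Reach T (cliqueOf T a) (cliqueOf T b) := by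
  simp only [Reach, inTypes_cliqueOf hT, outTypes_cliqueOf hT]
  refine ⟨?_, ?_, ?_, ?_⟩
  · rintro t ⟨c, hc, rfl⟩
    exact ⟨c, h.trans hT hc, rfl⟩
  · rintro t ⟨c, hc, rfl⟩
    exact ⟨c, below_of_near hT h (near_refl a) hc, rfl⟩
  · rintro t ⟨c, hc, rfl⟩
    exact ⟨c, below.trans hT hc h, rfl⟩
  · rintro t ⟨c, hc, rfl⟩
    exact ⟨c, below_of_near hT h hc (near_refl b), rfl⟩

theorem not_rel_of_not_reach (hT : ∀ a b c : M, rel T a b → rel T b c → rel T a c)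
    {a b : M} (hn : ¬ near T a b)
    (h : ¬ Reach T (cliqueOf T a) (cliqueOf T b)) : ¬ rel T a b := fun h' =>
  h (reach_of_below hT ⟨h', fun h'' => hn (Or.inr ⟨h', h''⟩)⟩)

theorem Reach.exists_above (hT : ∀ a b c : M, rel T a b → rel T b c → rel T a c) {a b : M}
    (h : Reach T (cliqueOf T a) (cliqueOf T b)) :
    ∃ c, below T a c ∧ oneType L c = oneType L b := by
  have := h.2.1 ⟨b, mem_cliqueOf_self b, rfl⟩
  rwa [outTypes_cliqueOf hT] at this

theorem exists_near_of_splice_eq [L.IsRelational] {a b a' : M}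
    (h : splice T (cliqueOf T a) = splice T (cliqueOf T b)) (ha : near T a a') :
    ∃ b', near T b b' ∧ oneType L b' = oneType L a' := by
  have h1 := typesOf_eq_of_isoType (congrArg Prod.fst h)
  obtain ⟨b', hb', h2⟩ := h1.subset ⟨a', ha, rfl⟩
  exact ⟨b', hb', h2⟩

variable (T) in
/-- The clique `B` may be copied: its splice is not unique, or copies may be put above copies. -/
def Multi [L.IsRelational] (B : Set M) : Prop :=
  (∃ b c : M, splice T (cliqueOf T b) = splice T B ∧ splice T (cliqueOf T c) = splice T B ∧
    ¬ near T b c) ∨ Reach T B B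

theorem multi_congr [L.IsRelational] {B C : Set M} (h : splice T B = splice T C) :
    Multi T B ↔ Multi T C := by
  simp only [Multi, h, reach_congr h h]

end Reach

/-! ### Heights of copies and the order between copies -/

section Positions

variable {m : ℕ} {M : Type w}

/-- Names of the copies of a clique: `none` in the initial segment, `some (j, _)` in the segment
`j + 1`. -/
abbrev Tag (m : ℕ) : Type := Option (ℕ × Option (Fin m))

namespace Tag

/-- The segment to which a copy belongs. -/
def level : Tag m → ℕ
  | none => 0
  | some (j, _) => j + 1

/-- The height at which a copy is placed. -/
def height (d : Fin m → Dir) : Tag m → ℤ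
  | none => 0
  | some (j, none) => if Even j then j + 1 else -(j + 1)
  | some (j, some i) => match d i with
    | Dir.fwd => j + 1
    | Dir.bwd => -(j + 1)

/-- Copies made for segment `j + 1` are thus strictly farther out than all copies in segments up to
`j`, on the side given by the sign. -/
theorem abs_height (d : Fin m → Dir) (t : Tag m) : |height d t| = level t := by
  have h : ∀ j : ℕ, |(j : ℤ) + 1| = (j + 1 : ℕ) := fun j => by
    rw [abs_of_nonneg (by positivity)]
    norm_cast
  rcases t with _ | ⟨j, _ | i⟩
  · rfl
  · simp only [height, level]
    split_ifs
    · exact h j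
    · rw [abs_neg, h j]
  · simp only [height, level]
    rcases d i with _ | _
    · exact h j
    · exact (abs_neg _).trans (h j)

theorem exists_height_lt (d : Fin m → Dir) (z : ℤ) : ∃ j, height d (some (j, none)) < z := by
  -- Spare copies with odd index lie below 0, those with even index above.
  refine ⟨2 * z.natAbs + 1, ?_⟩
  have h := neg_abs_le z
  have h' := abs_nonneg z
  have : ¬ Even (2 * z.natAbs + 1) := by simp
  simp only [height, this, if_false]
  push_cast
  omega

theorem exists_lt_height (d : Fin m → Dir) (z : ℤ) : ∃ j, z < height d (some (j, none)) := by
  refine ⟨2 * z.natAbs, ?_⟩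
  have h := le_abs_self z
  have h' := abs_nonneg z
  have : Even (2 * z.natAbs) := by simp
  simp only [height, this, if_true]
  push_cast
  omega

theorem height_lt_of_level_le {d : Fin m → Dir} {t : Tag m} {j : ℕ} (h : level t ≤ j)
    {i : Fin m} (hi : d i = Dir.fwd) : height d t < height d (some (j, some i)) := by
  have h1 := le_abs_self (height d t)
  rw [abs_height] at h1
  have h2 : height d (some (j, some i)) = j + 1 := by simp only [height, hi]
  omega

theorem lt_height_of_level_le {d : Fin m → Dir} {t : Tag m} {j : ℕ} (h : level t ≤ j)
    {i : Fin m} (hi : d i = Dir.bwd) : height d (some (j, some i)) < height d t := by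
  have h1 := neg_abs_le (height d t)
  rw [abs_height] at h1
  have h2 : height d (some (j, some i)) = -(j + 1) := by simp only [height, hi]
  omega

end Tag

/-- The linear order used for copies that can be put above each other in both ways. -/
def before (d : Fin m → Dir) (x y : Tag m × Set M) : Prop :=
  x.1.height d < y.1.height d ∨ x.1.height d = y.1.height d ∧ WellOrderingRel x y

variable {d : Fin m → Dir} {x y z : Tag m × Set M}

theorem before_irrefl : ¬ before d x x := by
  rintro (h | h)
  · exact h.false
  · exact irrefl _ h.2

theorem before.trans (h : before d x y) (h' : before d y z) : before d x z := by
  rcases h with h | h <;> rcases h' with h' | h'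
  · exact Or.inl (h.trans h')
  · exact Or.inl (h'.1 ▸ h)
  · exact Or.inl (h.1 ▸ h')
  · exact Or.inr ⟨h.1.trans h'.1, Trans.trans h.2 h'.2⟩

theorem before_trichotomy (h : ¬ before d x y) (h' : ¬ before d y x) : x = y := by
  simp only [before, not_or, not_and, not_lt] at h h'
  have he := le_antisymm h'.1 h.1
  rcases trichotomous_of WellOrderingRel x y with h1 | h1 | h1
  · exact absurd h1 (h.2 he)
  · exact h1
  · exact absurd h1 (h'.2 he.symm)

variable {L : FirstOrder.Language.{u, v}} {T : L.Relations 2} [L.Structure M]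

variable (d T) in
/-- The strict order between the copies of cliques. -/
def copyLt (x y : Tag m × Set M) : Prop :=
  Reach T x.2 y.2 ∧ (¬ Reach T y.2 x.2 ∨ before d x y)

theorem copyLt_irrefl : ¬ copyLt d T x x := fun h =>
  h.2.elim (fun h' => h' h.1) before_irrefl

/-- If `z` reaches back to `x`, all three reach one another, so both comparisons were made by the
transitive `before`. -/
theorem copyLt.trans (h : copyLt d T x y) (h' : copyLt d T y z) : copyLt d T x z := by
  refine ⟨h.1.trans h'.1, ?_⟩
  by_cases hzx : Reach T z.2 x.2
  · right
    have h1 := h.2.resolve_left (not_not.2 (h'.1.trans hzx))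
    have h2 := h'.2.resolve_left (not_not.2 (hzx.trans h.1))
    exact h1.trans h2
  · exact Or.inl hzx

theorem copyLt.asymm (h : copyLt d T x y) : ¬ copyLt d T y x := fun h' =>
  copyLt_irrefl (h.trans h')

theorem not_reach_of_not_copyLt (hxy : x ≠ y) (h : ¬ copyLt d T x y) (h' : ¬ copyLt d T y x) :
    ¬ Reach T x.2 y.2 := by
  intro hr
  by_cases hr' : Reach T y.2 x.2
  · exact hxy (before_trichotomy (fun hb => h ⟨hr, Or.inr hb⟩) fun hb => h' ⟨hr', Or.inr hb⟩)
  · exact h ⟨hr, Or.inl hr'⟩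

end Positions
end TransWit

namespace TransWit
-- Reduction to a model in the lowest universe
section LowenheimSkolem
open Cardinal FirstOrder.Language

variable {L : FirstOrder.Language.{u, v}}

theorem exists_model_of_countable {T : L.Relations 2} {Ψ : NormalForm L} {M : Type w}
    [L.Structure M] [Countable M] (h : IsModel T Ψ M) :
    ∃ (A : Type) (_ : L.Structure A), IsModel T Ψ A := by
  obtain ⟨f, hf⟩ := exists_injective_nat M
  let e : M ≃ Set.range f := _root_.Equiv.ofInjective f hf
  let : L.Structure (Set.range f) := e.inducedStructure
  let E : M ≃[L] Set.range f := e.inducedStructureEquiv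
  have hrel : ∀ a b : Set.range f, rel T a b ↔ rel T (E.symm a) (E.symm b) := by
    intro a b
    have h1 := E.symm.map_rel T ![a, b]
    have h2 : (E.symm ∘ ![a, b] : Fin 2 → M) = ![E.symm a, E.symm b] := by
      ext i; fin_cases i <;> rfl
    rw [h2] at h1
    exact h1.symm
  obtain ⟨⟨x⟩, h2, h3⟩ := h
  refine ⟨Set.range f, inferInstance, ⟨E x⟩, ?_, (StrongHomClass.realize_sentence E _).1 h3⟩
  intro a b c
  rw [hrel, hrel, hrel]
  exact h2 _ _ _

theorem exists_model_type_zero [L.IsRelational] [Finite (Σ n, L.Relations n)] {T : L.Relations 2} {Ψ : NormalForm L} {M : Type w}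
    [L.Structure M] (h : IsModel T Ψ M) :
    ∃ (A : Type) (_ : L.Structure A), IsModel T Ψ A := by
  rcases finite_or_infinite M with hM | hM
  · exact exists_model_of_countable h
  have hL : L.card ≤ ℵ₀ := by
    have : Countable L.Symbols := inferInstanceAs (Countable (_ ⊕ _))
    exact Cardinal.mk_le_aleph0_iff.2 this
  obtain ⟨S, -, hS⟩ := exists_elementarySubstructure_card_eq L (∅ : Set M) (ℵ₀ : Cardinal.{0}) le_rfl
    (by simp) (by simpa using hL) (by simp)
  have : Countable S := by
    rw [← Cardinal.mk_le_aleph0_iff]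
    simpa using hS.le
  refine exists_model_of_countable (M := S) (T := T) (Ψ := Ψ) ⟨inferInstance, ?_, ?_⟩
  · intro a b c hab hbc
    have hrel : ∀ a b : S, rel T a b ↔ rel T (a : M) (b : M) := by
      intro a b
      have h2 : (S.subtype ∘ ![a, b] : Fin 2 → M) = ![(a : M), (b : M)] := by
        ext i; fin_cases i <;> rfl
      have := S.subtype.map_rel T ![a, b]
      rw [h2] at this
      exact this.symm
    rw [hrel] at *
    exact h.2.1 _ _ _ hab hbc
  · exact (S.realize_sentence _).2 h.2.2
end LowenheimSkolem
-- The universe of the narrow structure and the choice of its 2-types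
section Narrow

variable {L : FirstOrder.Language.{u, v}} [L.IsRelational] {T : L.Relations 2}
  {Ψ : NormalForm L} {M : Type w} [L.Structure M]

/-- Choices made in a model: a clique for every splice, and a witness for every conjunct `γ_i`
and every element. -/
structure Plan (T : L.Relations 2) (Ψ : NormalForm L) (M : Type w) [L.Structure M] where
  trans : ∀ a b c : M, rel T a b → rel T b c → rel T a c
  rep : splices T M → M
  splice_rep : ∀ p, splice T (cliqueOf T (rep p)) = p
  wit : Fin Ψ.m → M → M
  wit_spec : ∀ i a, (Ψ.gammaMatrix T i).Realize default ![a, wit i a]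

theorem nonempty_plan (hM : IsModel T Ψ M) : Nonempty (Plan T Ψ M) := by
  have := hM.1
  have hT := hM.2.1
  have h1 : ∀ p : splices T M, ∃ a : M, splice T (cliqueOf T a) = p := by
    rintro ⟨p, B, hB, rfl⟩
    obtain ⟨a, rfl⟩ := (isClique_iff hT).1 hB
    exact ⟨a, rfl⟩
  choose r hr using h1
  choose g hg using ((isModel_iff T Ψ).1 hM).2.2.2.1
  exact ⟨⟨hT, r, hr, g, hg⟩⟩

namespace Plan

variable (P : Plan T Ψ M)

/-- The splice of the clique of an element. -/
def spl (a : M) : splices T M :=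
  ⟨splice T (cliqueOf T a), cliqueOf T a,
    have : Nonempty M := ⟨a⟩
    (isClique_iff P.trans).2 ⟨a, rfl⟩, rfl⟩

theorem spl_eq_iff {a b : M} :
    P.spl a = P.spl b ↔ splice T (cliqueOf T a) = splice T (cliqueOf T b) := Subtype.ext_iff

theorem spl_rep (p : splices T M) : P.spl (P.rep p) = p := Subtype.ext (P.splice_rep p)

theorem spl_eq_of_near {a b : M} (h : near T a b) : P.spl a = P.spl b := by
  rw [spl_eq_iff, (cliqueOf_eq_iff P.trans).2 h]

theorem splice_rep_spl (a : M) :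
    splice T (cliqueOf T (P.rep (P.spl a))) = splice T (cliqueOf T a) := P.splice_rep _

theorem near_of_not_multi {a b : M} (ha : ¬ Multi T (cliqueOf T a))
    (h : splice T (cliqueOf T b) = splice T (cliqueOf T a)) : near T b a := by
  by_contra hn
  exact ha (Or.inl ⟨b, a, h, rfl, hn⟩)

/-- The copies that are used: cliques chosen for a splice, those of witnesses for elements of
cliques that may not be copied, and infinitely many copies where possible. -/
def Adm : Tag Ψ.m → M → Prop
  | none, a => near T (P.rep (P.spl a)) a ∨
      ∃ b i, ¬ Multi T (cliqueOf T b) ∧ near T (P.wit i b) a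
  | some _, a => near T (P.rep (P.spl a)) a ∧ Multi T (cliqueOf T a)

theorem adm_of_near {t : Tag Ψ.m} {a b : M} (h : P.Adm t a) (hab : near T a b) : P.Adm t b := by
  have h1 := P.spl_eq_of_near hab
  have h2 := (cliqueOf_eq_iff P.trans).2 hab
  cases t with
  | none =>
    rcases h with h | ⟨c, i, hc, h⟩
    · exact Or.inl (h1 ▸ h.trans P.trans hab)
    · exact Or.inr ⟨c, i, hc, h.trans P.trans hab⟩
  | some x => exact ⟨h1 ▸ h.1.trans P.trans hab, h2 ▸ h.2⟩

theorem adm_of_not_multi {a : M} (h : ¬ Multi T (cliqueOf T a)) : P.Adm none a :=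
  Or.inl (near_of_not_multi h (P.splice_rep_spl a))

theorem adm_none_rep (p : splices T M) : P.Adm none (P.rep p) := by
  left
  rw [spl_rep]
  exact near_refl _

theorem adm_some_rep {a : M} (h : Multi T (cliqueOf T a)) (x : ℕ × Option (Fin Ψ.m)) :
    P.Adm (some x) (P.rep (P.spl a)) := by
  refine ⟨?_, (multi_congr (P.splice_rep_spl a)).2 h⟩
  rw [spl_rep]
  exact near_refl _

/-- The universe of the narrow structure. -/
abbrev Univ : Type w := {x : Tag Ψ.m × M // P.Adm x.1 x.2}

variable {P}

/-- The name of a copy. -/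
abbrev Univ.tag (x : P.Univ) : Tag Ψ.m := x.1.1

/-- The element of which `x` is a copy. -/
abbrev Univ.proj (x : P.Univ) : M := x.1.2

/-- The clique of which the clique of `x` is a copy, with the name of the copy. -/
abbrev Univ.copy (x : P.Univ) : Tag Ψ.m × Set M := (x.tag, cliqueOf T x.proj)

theorem Univ.copy_eq_iff {x y : P.Univ} :
    x.copy = y.copy ↔ x.tag = y.tag ∧ near T x.proj y.proj := by
  rw [Prod.mk.injEq, cliqueOf_eq_iff P.trans]

/-- The strict order on the cliques. -/
abbrev Univ.lt (x y : P.Univ) : Prop := copyLt Ψ.gammaDir T x.copy y.copy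

/-- The intended interpretation of `T` off the diagonal. -/
def Univ.le (x y : P.Univ) : Prop := x.copy = y.copy ∨ x.lt y

theorem Univ.le_trans (x y z : P.Univ) (h : x.le y) (h' : y.le z) : x.le z := by
  rcases h with h | h <;> rcases h' with h' | h'
  · exact Or.inl (h.trans h')
  · exact Or.inr (by rw [Univ.lt, h]; exact h')
  · exact Or.inr (by rw [Univ.lt, ← h']; exact h)
  · exact Or.inr (h.trans h')

theorem Univ.not_le_of_lt {x y : P.Univ} (h : x.lt y) : ¬ y.le x := by
  rintro (h' | h')
  · rw [Univ.lt, h'] at h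
    exact copyLt_irrefl h
  · exact h.asymm h'

theorem Univ.tag_of_not_multi {x : P.Univ} (h : ¬ Multi T (cliqueOf T x.proj)) :
    x.tag = none := by
  obtain ⟨⟨_ | t, a⟩, hx⟩ := x
  · rfl
  · exact absurd hx.2 h

/-- If `Reach` also held backwards, each clique would reach itself by transitivity, so both would be
`Multi`. -/
theorem Univ.lt_of_below {x y : P.Univ} (h : below T x.proj y.proj)
    (hs : ¬ Multi T (cliqueOf T x.proj) ∨ ¬ Multi T (cliqueOf T y.proj)) : x.lt y := by
  have h1 := reach_of_below P.trans h
  refine ⟨h1, Or.inl fun h2 => ?_⟩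
  rcases hs with hs | hs
  · exact hs (Or.inr (h1.trans h2))
  · exact hs (Or.inr (h2.trans h1))

theorem Univ.not_near_of_not_multi {x y : P.Univ} (hxy : x.copy ≠ y.copy)
    (hs : ¬ Multi T (cliqueOf T x.proj) ∨ ¬ Multi T (cliqueOf T y.proj)) :
    ¬ near T x.proj y.proj := by
  intro h
  have h1 := (cliqueOf_eq_iff P.trans).2 h
  rw [h1, or_self] at hs
  refine hxy (Univ.copy_eq_iff.2 ⟨?_, h⟩)
  rw [Univ.tag_of_not_multi hs, Univ.tag_of_not_multi (h1 ▸ hs)]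

/-- A pair of elements of the given structure from which the pair `x, y` may receive its type. -/
def Fits (x y : P.Univ) (a b : M) : Prop :=
  a ≠ b ∧ oneType L a = oneType L x.proj ∧ oneType L b = oneType L y.proj ∧
    (rel T a b ↔ x.le y) ∧ (rel T b a ↔ y.le x)

theorem Fits.symm {x y : P.Univ} {a b : M} (h : Fits x y a b) : Fits y x b a :=
  ⟨h.1.symm, h.2.2.1, h.2.1, h.2.2.2.2, h.2.2.2.1⟩

theorem fits_of_below {x y : P.Univ} {a b : M} (h : x.lt y) (hab : below T a b)
    (ha : oneType L a = oneType L x.proj) (hb : oneType L b = oneType L y.proj) :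
    Fits x y a b := by
  refine ⟨ne_of_not_near (not_near_of_below hab), ha, hb, ?_, ?_⟩
  · exact iff_of_true hab.1 (Or.inr h)
  · exact iff_of_false hab.2 (Univ.not_le_of_lt h)

theorem exists_fits_of_lt {x y : P.Univ} (h : x.lt y) : ∃ a b, Fits x y a b := by
  obtain ⟨c, hc, hc'⟩ := h.1.exists_above P.trans
  exact ⟨x.proj, c, fits_of_below h hc rfl hc'⟩

/-- For comparable copies, `Reach` supplies a pair with the right 1-types in the right order. For
incomparable ones `Reach` fails both ways, so elements of distinct cliques with these splices are
unrelated in `M`. -/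
theorem exists_fits {x y : P.Univ} (hxy : x.copy ≠ y.copy) : ∃ a b, Fits x y a b := by
  by_cases h1 : x.lt y
  · exact exists_fits_of_lt h1
  by_cases h2 : y.lt x
  · obtain ⟨a, b, h⟩ := exists_fits_of_lt h2
    exact ⟨b, a, h.symm⟩
  have h3 := not_reach_of_not_copyLt hxy h1 h2
  have h4 := not_reach_of_not_copyLt hxy.symm h2 h1
  have hle : ¬ x.le y := fun h => h.elim hxy h1
  have hle' : ¬ y.le x := fun h => h.elim hxy.symm h2
  have key : ∀ b, ¬ near T x.proj b → splice T (cliqueOf T b) = splice T (cliqueOf T y.proj) →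
      oneType L b = oneType L y.proj → ∃ a b, Fits x y a b := by
    intro b hn hs hb
    refine ⟨x.proj, b, ne_of_not_near hn, rfl, hb, iff_of_false ?_ hle, iff_of_false ?_ hle'⟩
    · exact not_rel_of_not_reach P.trans hn (by rwa [reach_congr rfl hs])
    · exact not_rel_of_not_reach P.trans (fun h => hn h.symm) (by rwa [reach_congr hs rfl])
  by_cases hn : near T x.proj y.proj
  · have hc := (cliqueOf_eq_iff P.trans).2 hn
    have hm : Multi T (cliqueOf T x.proj) := by
      by_contra hm
      exact Univ.not_near_of_not_multi hxy (Or.inl hm) hn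
    have h3' : ¬ Reach T (cliqueOf T x.proj) (cliqueOf T x.proj) := by
      have := h3
      simp only at this
      rwa [← hc] at this
    -- Two copies of one clique that does not reach itself: `Multi` yields two cliques with its
    -- splice, at least one of which is different from it.
    obtain ⟨b, c, hb, hc', hbc⟩ := hm.resolve_right h3'
    have : ∃ b, splice T (cliqueOf T b) = splice T (cliqueOf T x.proj) ∧ ¬ near T x.proj b := by
      by_cases hxb : near T x.proj b
      · exact ⟨c, hc', fun h => hbc (hxb.symm.trans P.trans h)⟩
      · exact ⟨b, hb, hxb⟩
    obtain ⟨b, hb, hxb⟩ := this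
    rw [hc] at hb
    obtain ⟨b', hbb', hb'⟩ := exists_near_of_splice_eq hb.symm (near_refl y.proj)
    refine key b' (fun h => hxb (h.trans P.trans hbb'.symm)) ?_ hb'
    rw [← (cliqueOf_eq_iff P.trans).2 hbb', hb]
  · exact key y.proj hn rfl rfl

/-- `y` may serve as a witness of the conjunct `γ_i` for `x`. -/
def Serves (x y : P.Univ) (i : Fin Ψ.m) : Prop :=
  (∃ j, y.tag = some (j, some i) ∧ x.tag.level ≤ j) ∧ Multi T (cliqueOf T x.proj) ∧
    ∃ a b, Fits x y a b ∧ (Ψ.gammaMatrix T i).Realize default ![a, b]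

/-- The requirements on the 2-type of a pair of elements. -/
def Demand (x y : P.Univ) (a b : M) : Prop :=
  (rel T a b ↔ x.le y) ∧
  (x.copy = y.copy → pairType L a b = pairType L x.proj y.proj) ∧
  (x.copy ≠ y.copy → (¬ Multi T (cliqueOf T x.proj) ∨ ¬ Multi T (cliqueOf T y.proj)) →
    rel T x.proj y.proj ∨ rel T y.proj x.proj → pairType L a b = pairType L x.proj y.proj) ∧
  ∀ i, Serves x y i → (Ψ.gammaMatrix T i).Realize default ![a, b]

theorem Serves.level_lt {x y : P.Univ} {i : Fin Ψ.m} (h : Serves x y i) :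
    x.tag.level < y.tag.level := by
  obtain ⟨⟨j, hj, hx⟩, -⟩ := h
  rw [hj]
  exact Nat.lt_succ_of_le hx

theorem Serves.multi {x y : P.Univ} {i : Fin Ψ.m} (h : Serves x y i) :
    Multi T (cliqueOf T x.proj) ∧ Multi T (cliqueOf T y.proj) := by
  obtain ⟨⟨j, hj, hx⟩, h1, -⟩ := h
  refine ⟨h1, ?_⟩
  by_contra hm
  rw [Univ.tag_of_not_multi hm] at hj
  cases hj

theorem exists_pair_of_copy_eq {x y : P.Univ} (hxy : x ≠ y) (h : x.copy = y.copy) :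
    ∃ a b, a ≠ b ∧ oneType L a = oneType L x.proj ∧ oneType L b = oneType L y.proj ∧
      Demand x y a b ∧ Demand y x b a := by
  obtain ⟨ht, hn⟩ := Univ.copy_eq_iff.1 h
  have hne : x.proj ≠ y.proj := fun h' => hxy (Subtype.ext (Prod.ext ht h'))
  have hr := hn.resolve_left hne
  refine ⟨x.proj, y.proj, hne, rfl, rfl, ⟨iff_of_true hr.1 (Or.inl h), fun _ => rfl,
    fun h' => absurd h h', fun i hi => ?_⟩, iff_of_true hr.2 (Or.inl h.symm), fun _ => rfl,
    fun h' => absurd h.symm h', fun i hi => ?_⟩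
  · exact absurd hi.level_lt (by rw [ht]; exact lt_irrefl _)
  · exact absurd hi.level_lt (by rw [ht]; exact lt_irrefl _)

theorem exists_pair_of_not_multi {x y : P.Univ} (hxy : x.copy ≠ y.copy)
    (hs : ¬ Multi T (cliqueOf T x.proj) ∨ ¬ Multi T (cliqueOf T y.proj))
    (hr : rel T x.proj y.proj ∨ rel T y.proj x.proj) :
    ∃ a b, a ≠ b ∧ oneType L a = oneType L x.proj ∧ oneType L b = oneType L y.proj ∧
      Demand x y a b ∧ Demand y x b a := by
  have hn := Univ.not_near_of_not_multi hxy hs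
  have hf : Fits x y x.proj y.proj := by
    rcases hr with h | h
    · have hb : below T x.proj y.proj := ⟨h, fun h' => hn (Or.inr ⟨h, h'⟩)⟩
      exact fits_of_below (Univ.lt_of_below hb hs) hb rfl rfl
    · have hb : below T y.proj x.proj := ⟨h, fun h' => hn (Or.inr ⟨h', h⟩)⟩
      exact (fits_of_below (Univ.lt_of_below hb hs.symm) hb rfl rfl).symm
  refine ⟨x.proj, y.proj, hf.1, rfl, rfl, ⟨hf.2.2.2.1, fun _ => rfl, fun _ _ _ => rfl,
    fun i hi => ?_⟩, hf.2.2.2.2, fun _ => rfl, fun _ _ _ => rfl, fun i hi => ?_⟩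
  · exact absurd hi.multi (by tauto)
  · exact absurd hi.multi (by tauto)

theorem exists_pair_of_not_serves {x y : P.Univ} (hxy : x.copy ≠ y.copy)
    (hs : (¬ Multi T (cliqueOf T x.proj) ∨ ¬ Multi T (cliqueOf T y.proj)) →
      ¬ (rel T x.proj y.proj ∨ rel T y.proj x.proj)) (hy : ∀ i, ¬ Serves y x i) :
    ∃ a b, a ≠ b ∧ oneType L a = oneType L x.proj ∧ oneType L b = oneType L y.proj ∧
      Demand x y a b ∧ Demand y x b a := by
  have key : ∃ a b, Fits x y a b ∧
      ∀ i, Serves x y i → (Ψ.gammaMatrix T i).Realize default ![a, b] := by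
    by_cases h : ∃ i, Serves x y i
    · obtain ⟨i, hi⟩ := h
      obtain ⟨⟨j, hj, -⟩, -, a, b, hf, hab⟩ := id hi
      refine ⟨a, b, hf, fun i' hi' => ?_⟩
      obtain ⟨⟨j', hj', -⟩, -⟩ := hi'
      -- The tag of `y` names the only conjunct that `y` may serve.
      have : i = i' := by
        rw [hj] at hj'
        simpa using (congrArg (fun t : Tag Ψ.m => t.bind Prod.snd) hj')
      exact this ▸ hab
    · obtain ⟨a, b, hf⟩ := exists_fits hxy
      exact ⟨a, b, hf, fun i hi => absurd ⟨i, hi⟩ h⟩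
  obtain ⟨a, b, hf, hg⟩ := key
  exact ⟨a, b, hf.1, hf.2.1, hf.2.2.1,
    ⟨hf.2.2.2.1, fun h => absurd h hxy, fun _ h h' => absurd h' (hs h), hg⟩,
    hf.2.2.2.2, fun h => absurd h.symm hxy, fun _ h h' => absurd h'.symm (hs h.symm),
    fun i hi => absurd hi (hy i)⟩

theorem exists_pair (x y : P.Univ) (hxy : x ≠ y) :
    ∃ a b, a ≠ b ∧ oneType L a = oneType L x.proj ∧ oneType L b = oneType L y.proj ∧
      Demand x y a b ∧ Demand y x b a := by
  by_cases h : x.copy = y.copy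
  · exact exists_pair_of_copy_eq hxy h
  by_cases hs : (¬ Multi T (cliqueOf T x.proj) ∨ ¬ Multi T (cliqueOf T y.proj)) ∧
      (rel T x.proj y.proj ∨ rel T y.proj x.proj)
  · exact exists_pair_of_not_multi h hs.1 hs.2
  -- Serving raises the level, so it never happens in both directions.
  by_cases hy : ∃ i, Serves y x i
  · obtain ⟨i, hi⟩ := hy
    obtain ⟨a, b, h1, h2, h3, h4, h5⟩ := exists_pair_of_not_serves (x := y) (y := x)
      (fun h' => h h'.symm) (fun h1 h2 => hs ⟨h1.symm, h2.symm⟩)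
      (fun j hj => absurd hi.level_lt hj.level_lt.not_gt)
    exact ⟨b, a, h1.symm, h3, h2, h5, h4⟩
  · exact exists_pair_of_not_serves h (fun h1 h2 => hs ⟨h1, h2⟩) fun i hi => hy ⟨i, hi⟩

end Plan
end Narrow
-- The narrow structure is a model with the same splices
section Realization

open FirstOrder.Language.Structure

variable {L : FirstOrder.Language.{u, v}} [L.IsRelational] {T : L.Relations 2}
  {Ψ : NormalForm L} {M : Type w} [L.Structure M]

namespace Plan

variable (P : Plan T Ψ M)

/-- The structure on the universe of the plan meets all the requirements. -/
structure IsRealization [L.Structure P.Univ] : Prop where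
  one : ∀ x : P.Univ, oneType L x = oneType L x.proj
  pair : ∀ x y : P.Univ, x ≠ y → ∃ a b, a ≠ b ∧ oneType L a = oneType L x.proj ∧
    oneType L b = oneType L y.proj ∧ Demand x y a b ∧ Demand y x b a ∧
    pairType L x y = pairType L a b

theorem exists_isRealization (hσ : ∀ n : ℕ, Nonempty (L.Relations n) → n = 1 ∨ n = 2) :
    ∃ _ : L.Structure P.Univ, P.IsRealization := by
  obtain ⟨S, h2, h1⟩ := exists_structure_of_pairs hσ (fun x : P.Univ => x.proj)
    (fun x y a b => Demand x y a b) (fun x y hxy => exists_pair x y hxy)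
  exact ⟨S, h1, h2⟩

namespace IsRealization

variable {P} [L.Structure P.Univ] (hP : P.IsRealization)

include hP

theorem rel_iff {x y : P.Univ} (hxy : x ≠ y) : rel T x y ↔ x.le y := by
  obtain ⟨a, b, -, -, -, hd, -, h⟩ := hP.pair x y hxy
  rw [rel_congr T h, hd.1]

theorem pairType_of_copy_eq {x y : P.Univ} (h : x.copy = y.copy) :
    pairType L x y = pairType L x.proj y.proj := by
  by_cases hxy : x = y
  · subst hxy
    exact pairType_self_iff.2 (hP.one x)
  · obtain ⟨a, b, -, -, -, hd, -, hp⟩ := hP.pair x y hxy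
    rw [hp, hd.2.1 h]

theorem pairType_of_not_multi {x y : P.Univ} (h : x.copy ≠ y.copy)
    (hs : ¬ Multi T (cliqueOf T x.proj) ∨ ¬ Multi T (cliqueOf T y.proj))
    (hr : rel T x.proj y.proj ∨ rel T y.proj x.proj) :
    pairType L x y = pairType L x.proj y.proj := by
  obtain ⟨a, b, -, -, -, hd, -, hp⟩ := hP.pair x y fun h' => h (by rw [h'])
  rw [hp, hd.2.2.1 h hs hr]

theorem realize_of_serves {x y : P.Univ} {i : Fin Ψ.m} (h : Serves x y i) :
    (Ψ.gammaMatrix T i).Realize default ![x, y] := by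
  have hxy : x ≠ y := fun h' => (h.level_lt).ne (by rw [h'])
  obtain ⟨a, b, hab, -, -, hd, -, hp⟩ := hP.pair x y hxy
  exact (realize_congr (withDir_isQF T _ (Ψ.gammaPsi i).2) hp (by simp [hab, hxy])).2
    (hd.2.2.2 i h)

theorem trans (x y z : P.Univ) : rel T x y → rel T y z → rel T x z := by
  refine trans_of_le Univ.le_trans (fun x y hxy => hP.rel_iff hxy) ?_ x y z
  intro x y hxy h h'
  obtain ⟨a, b, -, ha, -, -, -, hp⟩ := hP.pair x y hxy
  rw [rel_congr T hp] at h
  rw [rel_congr T (pairType_swap hp)] at h'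
  rw [rel_self_congr T ((hP.one x).trans ha.symm)]
  exact P.trans _ _ _ h h'

theorem near_iff {x y : P.Univ} : near T x y ↔ x.copy = y.copy := by
  by_cases hxy : x = y
  · subst hxy
    exact iff_of_true (near_refl x) rfl
  · simp only [near, hxy, false_or, hP.rel_iff hxy, hP.rel_iff (Ne.symm hxy)]
    constructor
    · rintro ⟨h | h, h'⟩
      · exact h
      · exact absurd h' (Univ.not_le_of_lt h)
    · exact fun h => ⟨Or.inl h, Or.inl h.symm⟩

theorem below_iff {x y : P.Univ} : below T x y ↔ x.lt y := by
  constructor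
  · intro h
    have hn := not_near_of_below h
    rw [hP.near_iff] at hn
    exact ((hP.rel_iff fun h' => hn (by rw [h'])).1 h.1).resolve_left hn
  · intro h
    have hxy : x ≠ y := by
      rintro rfl
      exact copyLt_irrefl h
    rw [below, hP.rel_iff hxy, hP.rel_iff hxy.symm]
    exact ⟨Or.inr h, Univ.not_le_of_lt h⟩

theorem cliqueOf_eq (x : P.Univ) :
    cliqueOf T x = {y : P.Univ | y.tag = x.tag ∧ near T x.proj y.proj} := by
  ext y
  change near T x y ↔ _
  rw [hP.near_iff, Univ.copy_eq_iff]
  exact and_congr_left' eq_comm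

theorem injOn_proj (x : P.Univ) : Set.InjOn (fun y : P.Univ => y.proj) (cliqueOf T x) := by
  intro y hy z hz h
  rw [hP.cliqueOf_eq] at hy hz
  exact Subtype.ext (Prod.ext (hy.1.trans hz.1.symm) h)

theorem image_proj_cliqueOf (x : P.Univ) :
    (fun y : P.Univ => y.proj) '' cliqueOf T x = cliqueOf T x.proj := by
  rw [hP.cliqueOf_eq]
  ext b
  constructor
  · rintro ⟨y, hy, rfl⟩
    exact hy.2
  · intro hb
    exact ⟨⟨(x.tag, b), P.adm_of_near x.2 hb⟩, ⟨rfl, hb⟩, rfl⟩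

theorem encard_cliqueOf (x : P.Univ) : (cliqueOf T x).encard = (cliqueOf T x.proj).encard := by
  rw [← hP.image_proj_cliqueOf, (hP.injOn_proj x).encard_image]

theorem isoType_cliqueOf (hσ : ∀ n : ℕ, Nonempty (L.Relations n) → n = 1 ∨ n = 2)
    (x : P.Univ) : isoType L (cliqueOf T x) = isoType L (cliqueOf T x.proj) := by
  rw [← hP.image_proj_cliqueOf]
  refine isoType_eq (Equiv.Set.imageOfInjOn _ _ (hP.injOn_proj x)) fun n R t => ?_
  have hval : (fun i => ((Equiv.Set.imageOfInjOn _ _ (hP.injOn_proj x)) (t i) : M)) =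
      fun i => (t i : P.Univ).proj := rfl
  rw [hval]
  rcases hσ n ⟨R⟩ with rfl | rfl
  · have h := Set.ext_iff.1 (hP.one (t 0)) ⟨1, R⟩
    have h1 : (fun i => (t i : P.Univ)) = fun _ => (t 0 : P.Univ) := by
      ext1 i; fin_cases i; rfl
    have h2 : (fun i => (t i : P.Univ).proj) = fun _ => (t 0 : P.Univ).proj := by
      ext1 i; fin_cases i; rfl
    rw [h1, h2]
    exact h.symm
  · have hc : (t 0 : P.Univ).copy = (t 1 : P.Univ).copy :=
      (hP.near_iff.1 (t 0).2).symm.trans (hP.near_iff.1 (t 1).2)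
    have h := Set.ext_iff.1 (hP.pairType_of_copy_eq hc) ⟨⟨2, R⟩, id⟩
    have h1 : (fun i => (t i : P.Univ)) = ![(t 0 : P.Univ), (t 1 : P.Univ)] := by
      ext1 i; fin_cases i <;> rfl
    have h2 : (fun i => (t i : P.Univ).proj) =
        ![(t 0 : P.Univ).proj, (t 1 : P.Univ).proj] := by
      ext1 i; fin_cases i <;> rfl
    rw [h1, h2]
    exact h.symm

/-- Nothing new appears because the order respects `Reach`. Nothing is lost: a `Multi` clique has
spare copies of arbitrarily low height, and a clique that is not `Multi` occurs in segment 0 and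
keeps its place. -/
theorem inTypes_cliqueOf (x : P.Univ) :
    inTypes T (cliqueOf T x) = inTypes T (cliqueOf T x.proj) := by
  apply Set.Subset.antisymm
  · rw [TransWit.inTypes_cliqueOf hP.trans]
    rintro _ ⟨y, hy, rfl⟩
    rw [hP.one]
    exact (hP.below_iff.1 hy).1.2.2.2 ⟨y.proj, mem_cliqueOf_self _, rfl⟩
  · rw [TransWit.inTypes_cliqueOf hP.trans, TransWit.inTypes_cliqueOf P.trans]
    rintro _ ⟨b, hb, rfl⟩
    by_cases hm : Multi T (cliqueOf T b)
    · obtain ⟨b', hb', h⟩ := exists_near_of_splice_eq (P.splice_rep_spl b).symm (near_refl b)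
      obtain ⟨j, hj⟩ := Tag.exists_height_lt Ψ.gammaDir (x.tag.height Ψ.gammaDir)
      refine ⟨⟨(some (j, none), b'), P.adm_of_near (P.adm_some_rep hm _) hb'⟩,
        hP.below_iff.2 ⟨?_, Or.inr (Or.inl hj)⟩, (hP.one _).trans h⟩
      refine (reach_congr ?_ rfl).1 (reach_of_below P.trans hb)
      exact (P.splice_rep_spl b).symm.trans
        (by rw [(cliqueOf_eq_iff P.trans).2 hb'])
    · exact ⟨⟨(none, b), P.adm_of_not_multi hm⟩,
        hP.below_iff.2 (Univ.lt_of_below hb (Or.inl hm)), hP.one _⟩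

theorem outTypes_cliqueOf (x : P.Univ) :
    outTypes T (cliqueOf T x) = outTypes T (cliqueOf T x.proj) := by
  apply Set.Subset.antisymm
  · rw [TransWit.outTypes_cliqueOf hP.trans]
    rintro _ ⟨y, hy, rfl⟩
    rw [hP.one]
    exact (hP.below_iff.1 hy).1.2.1 ⟨y.proj, mem_cliqueOf_self _, rfl⟩
  · rw [TransWit.outTypes_cliqueOf hP.trans, TransWit.outTypes_cliqueOf P.trans]
    rintro _ ⟨b, hb, rfl⟩
    by_cases hm : Multi T (cliqueOf T b)
    · obtain ⟨b', hb', h⟩ := exists_near_of_splice_eq (P.splice_rep_spl b).symm (near_refl b)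
      obtain ⟨j, hj⟩ := Tag.exists_lt_height Ψ.gammaDir (x.tag.height Ψ.gammaDir)
      refine ⟨⟨(some (j, none), b'), P.adm_of_near (P.adm_some_rep hm _) hb'⟩,
        hP.below_iff.2 ⟨?_, Or.inr (Or.inl hj)⟩, (hP.one _).trans h⟩
      refine (reach_congr rfl ?_).1 (reach_of_below P.trans hb)
      exact (P.splice_rep_spl b).symm.trans
        (by rw [(cliqueOf_eq_iff P.trans).2 hb'])
    · exact ⟨⟨(none, b), P.adm_of_not_multi hm⟩,
        hP.below_iff.2 (Univ.lt_of_below hb (Or.inr hm)), hP.one _⟩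

theorem splice_cliqueOf (hσ : ∀ n : ℕ, Nonempty (L.Relations n) → n = 1 ∨ n = 2)
    (x : P.Univ) : splice T (cliqueOf T x) = splice T (cliqueOf T x.proj) := by
  rw [splice, splice, hP.isoType_cliqueOf hσ, hP.inTypes_cliqueOf, hP.outTypes_cliqueOf]

theorem splices_eq [Nonempty M] (hσ : ∀ n : ℕ, Nonempty (L.Relations n) → n = 1 ∨ n = 2) :
    splices T P.Univ = splices T M := by
  have hne : Nonempty P.Univ := by
    obtain ⟨a⟩ := ‹Nonempty M›
    exact ⟨⟨(none, P.rep (P.spl a)), P.adm_none_rep _⟩⟩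
  ext p
  constructor
  · rintro ⟨B, hB, rfl⟩
    obtain ⟨x, rfl⟩ := (isClique_iff hP.trans).1 hB
    exact ⟨_, (isClique_iff P.trans).2 ⟨x.proj, rfl⟩, (hP.splice_cliqueOf hσ x).symm⟩
  · intro hp
    let x : P.Univ := ⟨(none, P.rep ⟨p, hp⟩), P.adm_none_rep _⟩
    exact ⟨_, (isClique_iff hP.trans).2 ⟨x, rfl⟩,
      (hP.splice_cliqueOf hσ x).trans (P.splice_rep ⟨p, hp⟩)⟩

/-- Witnesses are found in the initial segment or in all later segments. -/
theorem exists_witness (x : P.Univ) (i : Fin Ψ.m) :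
    (∃ y : P.Univ, y.tag.level = 0 ∧ (Ψ.gammaMatrix T i).Realize default ![x, y] ∧ x ≠ y) ∨
      ∀ j, x.tag.level ≤ j → ∃ y : P.Univ, y.tag.level = j + 1 ∧
        (Ψ.gammaMatrix T i).Realize default ![x, y] ∧ x ≠ y := by
  have hw := P.wit_spec i x.proj
  set b := P.wit i x.proj with hb
  have hdir : Ψ.gammaDir i = Dir.fwd ∧ below T x.proj b ∨
      Ψ.gammaDir i = Dir.bwd ∧ below T b x.proj := by
    rw [NormalForm.gammaMatrix] at hw
    rcases hd : Ψ.gammaDir i with _ | _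
    · rw [hd, realize_withDir_fwd] at hw
      exact Or.inl ⟨rfl, hw.1⟩
    · rw [hd, realize_withDir_bwd] at hw
      exact Or.inr ⟨rfl, hw.1⟩
  have hn : ¬ near T x.proj b := by
    rcases hdir with ⟨-, h⟩ | ⟨-, h⟩
    · exact not_near_of_below h
    · exact fun h' => not_near_of_below h h'.symm
  have hr : rel T x.proj b ∨ rel T b x.proj := hdir.imp (fun h => h.2.1) fun h => h.2.1
  -- If one of the cliques cannot be copied, `b` itself is present in segment 0 and the 2-type of
  -- the pair is kept.
  by_cases hs : ¬ Multi T (cliqueOf T x.proj) ∨ ¬ Multi T (cliqueOf T b)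
  · left
    have hadm : P.Adm none b := by
      rcases hs with hs | hs
      · exact Or.inr ⟨x.proj, i, hs, near_refl b⟩
      · exact P.adm_of_not_multi hs
    let y : P.Univ := ⟨(none, b), hadm⟩
    have hc : x.copy ≠ y.copy := fun h => hn (Univ.copy_eq_iff.1 h).2
    have hxy : x ≠ y := fun h => hc (by rw [h])
    exact ⟨y, rfl, (realize_congr (withDir_isQF T _ (Ψ.gammaPsi i).2)
      (hP.pairType_of_not_multi hc hs hr) (iff_of_false hxy (ne_of_not_near hn))).2 hw, hxy⟩
  · right
    intro j hj
    simp only [not_or, not_not] at hs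
    obtain ⟨b', hb', h⟩ := exists_near_of_splice_eq (P.splice_rep_spl b).symm (near_refl b)
    have hs' : splice T (cliqueOf T b) = splice T (cliqueOf T b') :=
      (P.splice_rep_spl b).symm.trans (by rw [(cliqueOf_eq_iff P.trans).2 hb'])
    -- This copy is reserved for `γ_i`; its height beats that of `x` in the required direction even
    -- when `Reach` holds both ways.
    let y : P.Univ := ⟨(some (j, some i), b'), P.adm_of_near (P.adm_some_rep hs.2 _) hb'⟩
    have hfits : Fits x y x.proj b := by
      rcases hdir with ⟨hd, hbelow⟩ | ⟨hd, hbelow⟩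
      · exact fits_of_below ⟨(reach_congr rfl hs').1 (reach_of_below P.trans hbelow),
          Or.inr (Or.inl (Tag.height_lt_of_level_le hj hd))⟩ hbelow rfl h.symm
      · exact (fits_of_below (x := y) ⟨(reach_congr hs' rfl).1 (reach_of_below P.trans hbelow),
          Or.inr (Or.inl (Tag.lt_height_of_level_le hj hd))⟩ hbelow h.symm rfl).symm
    have hserve : Serves x y i := ⟨⟨j, rfl, hj⟩, hs.1, x.proj, b, hfits, hw⟩
    refine ⟨y, rfl, hP.realize_of_serves hserve, fun h => ?_⟩
    exact hserve.level_lt.ne (by rw [h])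

theorem isModel (hM : IsModel T Ψ M) : IsModel T Ψ P.Univ := by
  have hM' := (isModel_iff T Ψ).1 hM
  refine (isModel_iff T Ψ).2 ⟨?_, hP.trans, ?_, ?_, ?_⟩
  · obtain ⟨a⟩ := hM.1
    exact ⟨⟨(none, P.rep (P.spl a)), P.adm_none_rep _⟩⟩
  · refine realize_psi0_of_pairs hM hP.one fun x y hxy => ?_
    obtain ⟨a, b, hab, -, -, -, -, h⟩ := hP.pair x y hxy
    exact ⟨a, b, hab, h⟩
  · intro i x
    rcases hP.exists_witness x i with ⟨y, -, hy, -⟩ | h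
    · exact ⟨y, hy⟩
    · obtain ⟨y, -, hy, -⟩ := h _ le_rfl
      exact ⟨y, hy⟩
  · intro i x
    obtain ⟨b, hb⟩ := hM'.2.2.2.2 i x.proj
    have hb' := (realize_withBoth T _ _ _).1 hb
    have hn : near T x.proj b := Or.inr ⟨hb'.1, hb'.2.1⟩
    let y : P.Univ := ⟨(x.tag, b), P.adm_of_near x.2 hn⟩
    have hc : x.copy = y.copy := Univ.copy_eq_iff.2 ⟨rfl, hn⟩
    refine ⟨y, (realize_congr (withBoth_isQF T (Ψ.deltaPsi i).2)
      (hP.pairType_of_copy_eq hc) ?_).2 hb⟩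
    exact ⟨fun h => by rw [h], fun h => Subtype.ext (Prod.ext rfl h)⟩

end IsRealization

end Plan

end Realization
-- Sizes of the segments and the final assembly
section NarrowModel

variable {L : FirstOrder.Language.{u, v}} [L.IsRelational] {T : L.Relations 2}
  {Ψ : NormalForm L} {M : Type w} [L.Structure M]

namespace Plan

variable (P : Plan T Ψ M)

/-- The `j`-th segment of the narrow structure. -/
def segment (j : ℕ) : Set P.Univ := {x | x.tag.level = j}

/-- A non-`Multi` clique is the one chosen for its splice. Its witnesses' cliques are therefore
coded by a splice, a position in the chosen clique, a conjunct, and a position in the clique of the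
witness; hence the factor `H ^ 2`. -/
theorem encard_segment_zero_le [Finite (splices T M)] {H : ℕ}
    (hH : ∀ a : M, (cliqueOf T a).encard ≤ H) :
    (P.segment 0).encard ≤ (((splices T M).ncard * H +
      (splices T M).ncard * (H * (Ψ.m * H)) : ℕ) : ℕ∞) := by
  have h1 : ∀ a : M, ∃ e : Fin H → M, Set.range e = cliqueOf T a := fun a =>
    exists_range_eq_of_encard_le ⟨a, mem_cliqueOf_self a⟩ (hH a)
  choose e he using h1
  have h2 : ∀ {a b : M}, near T a b → ∃ k, e a k = b := fun {a b} h => by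
    have : b ∈ Set.range (e a) := by rw [he]; exact h
    exact this
  have hcard : Nat.card (splices T M × Fin H ⊕ splices T M × Fin H × Fin Ψ.m × Fin H) =
      (splices T M).ncard * H + (splices T M).ncard * (H * (Ψ.m * H)) := by
    simp only [Nat.card_sum, Nat.card_prod, Nat.card_fin, Nat.card_coe_set_eq]
  rw [← hcard]
  let decode : splices T M × Fin H ⊕ splices T M × Fin H × Fin Ψ.m × Fin H → M
    | Sum.inl (p, k) => e (P.rep p) k
    | Sum.inr (p, k, i, l) => e (P.wit i (e (P.rep p) k)) l
  have htag : ∀ x ∈ P.segment 0, x.tag = none := by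
    rintro ⟨⟨_ | _, a⟩, hx⟩ h
    · rfl
    · exact absurd h (Nat.succ_ne_zero _)
  refine encard_le_of_code (fun x t => x.proj = decode t) ?_ ?_
  · rintro ⟨⟨t, a⟩, hx⟩ hx0
    obtain rfl : t = none := htag _ hx0
    rcases hx with hx | ⟨b, i, hb, hx⟩
    · obtain ⟨k, hk⟩ := h2 hx
      exact ⟨Sum.inl (_, k), hk.symm⟩
    · obtain ⟨k, hk⟩ := h2 (near_of_not_multi hb (P.splice_rep_spl b))
      obtain ⟨l, hl⟩ := h2 hx
      refine ⟨Sum.inr (P.spl b, k, i, l), ?_⟩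
      change a = e (P.wit i (e (P.rep (P.spl b)) k)) l
      rw [hk, hl]
  · intro x hx y hy t h h'
    exact Subtype.ext (Prod.ext ((htag x hx).trans (htag y hy).symm) (h.trans h'.symm))

theorem encard_segment_succ_le [Finite (splices T M)] {H : ℕ}
    (hH : ∀ a : M, (cliqueOf T a).encard ≤ H) (j : ℕ) :
    (P.segment (j + 1)).encard ≤ (((Ψ.m + 1) * ((splices T M).ncard * H) : ℕ) : ℕ∞) := by
  have hcard : Nat.card (Option (Fin Ψ.m) × splices T M × Fin H) =
      (Ψ.m + 1) * ((splices T M).ncard * H) := by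
    simp only [Nat.card_prod, Nat.card_fin, Nat.card_coe_set_eq, Finite.card_option]
  rw [← hcard]
  have h1 : ∀ a : M, ∃ e : Fin H → M, Set.range e = cliqueOf T a := fun a =>
    exists_range_eq_of_encard_le ⟨a, mem_cliqueOf_self a⟩ (hH a)
  choose e he using h1
  refine encard_le_of_code
    (fun x t => x.tag = some (j, t.1) ∧ x.proj = e (P.rep t.2.1) t.2.2) ?_ ?_
  · rintro ⟨⟨_ | ⟨k, i⟩, a⟩, hx⟩ h
    · exact absurd h (Nat.succ_ne_zero _).symm
    · obtain rfl : k = j := Nat.succ.inj h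
      have : a ∈ Set.range (e (P.rep (P.spl a))) := by rw [he]; exact hx.1
      obtain ⟨l, hl⟩ := this
      exact ⟨(i, P.spl a, l), rfl, hl.symm⟩
  · intro x hx y hy t h h'
    exact Subtype.ext (Prod.ext (h.1.trans h'.1.symm) (h.2.trans h'.2.symm))

variable {P}

theorem IsRealization.uniquePart_subset [Nonempty M] [L.Structure P.Univ]
    (hP : P.IsRealization) (hσ : ∀ n : ℕ, Nonempty (L.Relations n) → n = 1 ∨ n = 2) :
    uniquePart T P.Univ ⊆ P.segment 0 := by
  have hne : Nonempty P.Univ := by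
    obtain ⟨a⟩ := ‹Nonempty M›
    exact ⟨⟨(none, P.rep (P.spl a)), P.adm_none_rep _⟩⟩
  rintro x ⟨B, ⟨hB, hu⟩, hx⟩
  obtain ⟨y, rfl⟩ := (isClique_iff hP.trans).1 hB
  have hyx : cliqueOf T y = cliqueOf T x := (cliqueOf_eq_iff hP.trans).2 hx
  rw [hyx] at hu
  obtain ⟨⟨_ | ⟨j, i⟩, a⟩, hadm⟩ := x
  · rfl
  -- The copy in the next segment has the same splice.
  · refine absurd ⟨_, (isClique_iff hP.trans).2 ⟨⟨(some (j + 1, i), a), hadm⟩, rfl⟩, ?_, ?_⟩ hu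
    · rw [hP.splice_cliqueOf hσ, hP.splice_cliqueOf hσ]
    · rw [ne_eq, cliqueOf_eq_iff hP.trans, hP.near_iff, Univ.copy_eq_iff]
      exact fun h => by simpa [Univ.tag] using h.1

theorem IsRealization.isNarrow [L.Structure P.Univ] (hP : P.IsRealization)
    (hσ : ∀ n : ℕ, Nonempty (L.Relations n) → n = 1 ∨ n = 2) [Finite (splices T M)] {H h : ℕ}
    (hH : ∀ a : M, (cliqueOf T a).encard ≤ H) (hh : H ^ 2 ≤ h)
    {a : M} (ha : Multi T (cliqueOf T a)) : IsNarrow T Ψ P.Univ h := by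
  have hne : Nonempty M := ⟨a⟩
  have hHh : H ≤ h := (Nat.le_self_pow two_ne_zero H).trans hh
  refine Or.inr ⟨P.segment, ?_, ?_, ?_, hP.uniquePart_subset hσ, fun j => ⟨?_, ?_⟩⟩
  · rintro (_ | j)
    · exact ⟨⟨(none, P.rep (P.spl a)), P.adm_none_rep _⟩, rfl⟩
    · exact ⟨⟨(some (j, none), P.rep (P.spl a)), P.adm_some_rep ha _⟩, rfl⟩
  · intro i j hij
    refine Set.disjoint_left.2 fun x hi hj => hij ?_
    exact Eq.trans (Eq.symm hi) hj
  · exact Set.iUnion_eq_univ_iff.2 fun x => ⟨_, rfl⟩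
  · rw [segmentBound, hP.splices_eq hσ]
    have hs : (splices T M).ncard ≤ (splices T M).ncard ^ 2 := Nat.le_self_pow two_ne_zero _
    cases j with
    | zero =>
      refine (P.encard_segment_zero_le hH).trans ?_
      generalize (splices T M).ncard = s at *
      norm_cast
      calc s * H + s * (H * (Ψ.m * H)) = s * (H + Ψ.m * H ^ 2) := by ring
        _ ≤ s ^ 2 * (h + Ψ.m * h) := by gcongr
        _ = (Ψ.m + 1) * s ^ 2 * h := by ring
    | succ j =>
      refine (P.encard_segment_succ_le hH j).trans ?_
      generalize (splices T M).ncard = s at *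
      norm_cast
      calc (Ψ.m + 1) * (s * H) ≤ (Ψ.m + 1) * (s ^ 2 * h) := by gcongr
        _ = (Ψ.m + 1) * s ^ 2 * h := by ring
  · intro x hx i hi
    have hx' : x.tag.level ≤ j := by
      simp only [Set.mem_iUnion] at hx
      obtain ⟨k, hk, hxk⟩ := hx
      exact (Eq.le hxk).trans hk
    rcases hP.exists_witness x i with ⟨y, hy, hw⟩ | hw
    · exact absurd (show y ∈ witnesses T Ψ i x ∩ P.segment 0 from ⟨hw, hy⟩) (by simp [hi])
    · obtain ⟨y, hy, hw⟩ := hw j hx'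
      exact ⟨y, hw, hy⟩

end Plan

theorem uniquePart_eq_univ [Nonempty M]
    (hT : ∀ a b c : M, rel T a b → rel T b c → rel T a c)
    (h : ∀ a : M, ¬ Multi T (cliqueOf T a)) : uniquePart T M = Set.univ := by
  refine Set.eq_univ_of_forall fun a => ⟨cliqueOf T a, ⟨(isClique_iff hT).2 ⟨a, rfl⟩, ?_⟩,
    mem_cliqueOf_self a⟩
  rintro ⟨C, hC, hs, hne⟩
  obtain ⟨b, rfl⟩ := (isClique_iff hT).1 hC
  exact hne ((cliqueOf_eq_iff hT).2 (Plan.near_of_not_multi (h b) hs))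

theorem exists_narrow_model [Finite (Σ n, L.Relations n)]
    (hσ : ∀ n : ℕ, Nonempty (L.Relations n) → n = 1 ∨ n = 2) (hM : IsModel T Ψ M)
    (hH : ∀ a : M, (cliqueOf T a).encard ≤ ((2 ^ (15 * sigSize L) : ℕ) : ℕ∞)) :
    ∃ (A : Type w) (_ : L.Structure A), IsModel T Ψ A ∧ HasSmallCliques T A 40 ∧
      IsNarrow T Ψ A (cliqueBound L 40) := by
  have hsmall : ∀ (A : Type w) [L.Structure A], IsModel T Ψ A →
      (∀ a : A, (cliqueOf T a).encard ≤ ((2 ^ (15 * sigSize L) : ℕ) : ℕ∞)) →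
      HasSmallCliques T A 40 := by
    intro A _ hA hH
    have := hA.1
    refine ⟨fun B hB => ?_, encard_splices_le hσ hA.2.1 hH⟩
    obtain ⟨a, rfl⟩ := (isClique_iff hA.2.1).1 hB
    refine (hH a).trans ?_
    exact_mod_cast Nat.pow_le_pow_right two_pos (by omega)
  have hne := hM.1
  by_cases hm : ∀ a : M, ¬ Multi T (cliqueOf T a)
  · exact ⟨M, inferInstance, hM, hsmall M hM hH, Or.inl (uniquePart_eq_univ hM.2.1 hm)⟩
  · push Not at hm
    obtain ⟨a, ha⟩ := hm
    obtain ⟨P⟩ := nonempty_plan hM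
    obtain ⟨_, hP⟩ := P.exists_isRealization hσ
    have hU := hP.isModel hM
    have : Finite (splices T M) :=
      (Set.finite_of_encard_le_coe (encard_splices_le hσ hM.2.1 hH)).to_subtype
    refine ⟨P.Univ, inferInstance, hU, hsmall _ hU fun x => ?_, hP.isNarrow hσ hH ?_ ha⟩
    · rw [hP.encard_cliqueOf]
      exact hH _
    -- The square of the actual clique bound `2 ^ (15|σ|)` fits into `h = 2 ^ (40|σ|)`, which
    -- absorbs the `H ^ 2` of segment 0.
    · rw [← pow_mul]
      exact Nat.pow_le_pow_right two_pos (by omega)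

end NarrowModel
end TransWit

theorem mainTheorem4 :
    ∃ c : ℕ, ∀ (L : FirstOrder.Language.{u, v}) [L.IsRelational] [Finite (Σ n, L.Relations n)],
      (∀ n : ℕ, Nonempty (L.Relations n) → n = 1 ∨ n = 2) →
      ∀ (T : L.Relations 2) (Ψ : TransWit.NormalForm L),
        (∃ (M : Type w) (_ : L.Structure M), TransWit.IsModel T Ψ M) →
        ∃ (A : Type) (_ : L.Structure A),
          TransWit.IsModel T Ψ A ∧ TransWit.HasSmallCliques T A c ∧
            TransWit.IsNarrow T Ψ A (TransWit.cliqueBound L c) := by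
  -- The value 40 leaves room both for the squared clique size, with exponent `30|σ|`, and for the
  -- splice count, whose upper exponent is at most `2 + 31|σ|`.
  refine ⟨40, fun L _ _ hσ T Ψ => ?_⟩
  rintro ⟨M, _, hM⟩
  obtain ⟨A, _, hA⟩ := TransWit.exists_model_type_zero hM
  obtain ⟨B, _, hB, hH⟩ := TransWit.exists_model_small_cliques hσ hA
  exact TransWit.exists_narrow_model hσ hB hH
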